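/- **Setting.** Let $\mathcal X$ be a measurable space, $\Theta\subset\mathbb R^d$ open, and let $r(x;\theta)>0$ ($x\in\mathcal X$, $\theta\in\Theta$) be measurable in $x$ and continuously differentiable in $\theta$. Let $f$ be strictly convex and differentiable on $(0,\infty)$ and let $0<\rho<\infty$. For a vector-valued function $g=(g_1,\dots,g_d)$ on $\mathcal X$ put $\mathcal L[g]=\{\sum_k a_kg_k : a\in\mathbb R^d\}$; $\nabla$ is the gradient in $\theta$. Assume: (a) $r(\cdot;\theta)\equiv1$ for some $\theta\in\Theta$; (b) $1\in\mathcal L[\nabla\log r(\cdot;\theta)]$ for all $\theta\in\Theta$; (c) $f(1)=f'(1)=0$. A *truth* is a triple $P=(\theta,p_{\mathrm n},p_{\mathrm d})$ with $\theta\in\Theta$ and $p_{\mathrm n},p_{\mathrm d}$ probability distributions on $\mathcal X$ such that $p_{\mathrm n}(dx)=r(x;\theta)\,p_{\mathrm d}(dx)$; $\mathrm E_{\mathrm n},\mathrm V_{\mathrm n}$ and $\mathrm E_{\mathrm d},\mathrm V_{\mathrm d}$ are expectation and variance under $p_{\mathrm n}$ and $p_{\mathrm d}$. The quantity to be estimated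 is $D_f=\int f(dp_{\mathrm n}/dp_{\mathrm d})\,dp_{\mathrm d}$. **Estimators.** An estimator is given by a function $\eta:\mathcal X\times\Theta\to\mathbb R^d$ and a decomposition $f(t)=f_{\mathrm d}(t)+t f_{\mathrm n}(t)$, $t>0$. From independent i.i.d. samples $x^{(\mathrm n)}_1,\dots,x^{(\mathrm n)}_{m_{\mathrm n}}\sim p_{\mathrm n}$ and $x^{(\mathrm d)}_1,\dots,x^{(\mathrm d)}_{m_{\mathrm d}}\sim p_{\mathrm d}$, with $m_{\mathrm n},m_{\mathrm d}\to\infty$ and $m_{\mathrm n}/m_{\mathrm d}\to\rho$, let $\widehat\theta$ be a $\Theta$-valued consistent estimator of $\theta$ that solves, with probability tending to one, $$Q_\eta(\widehat\theta):=\frac1{m_{\mathrm d}}\sum_i r(x^{(\mathrm d)}_i;\widehat\theta)\,\eta(x^{(\mathrm d)}_i;\widehat\theta)-\frac1{m_{\mathrm n}}\sum_j\eta(x^{(\mathrm n)}_j;\widehat\theta)=0,$$ and set $$\widehat D_f=\frac1{m_{\mathrm d}}\sum_i f_{\mathrm d}(r(x^{(\mathrm d)}_i;\widehat\theta))+\frac1{m_{\mathrm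 n}}\sum_j f_{\mathrm n}(r(x^{(\mathrm n)}_j;\widehat\theta)).$$ The asymptotic variance of $\widehat D_f$ at $P$ is the number $v\ge 0$ such that, for every such $\widehat\theta$, $\sqrt m(\widehat D_f-D_f)$ converges in law to $N(0,v)$, where $m=m_{\mathrm n}m_{\mathrm d}/(m_{\mathrm n}+m_{\mathrm d})$. Put $$U_\eta=\mathrm E_{\mathrm n}[\eta\,\nabla\log r^T],\qquad c=\mathrm E_{\mathrm n}[\{f'(r)-f_{\mathrm n}(r)\}\nabla\log r],$$ where here and in $\sigma^2$ below all functions are evaluated at $(x;\theta)$. The estimator is *regular* at $P$ if $f_{\mathrm d},f_{\mathrm n}$ are $C^1$ on $(0,\infty)$; $\eta$ is measurable in $x$ and $C^1$ in $\theta$; $f_{\mathrm d}(r),\,r\eta\in L^2(p_{\mathrm d})$ and $f_{\mathrm n}(r),\,\eta\in L^2(p_{\mathrm n})$ at $\theta$; in a neighbourhood of $\theta$ the first $\theta$-derivatives of $f_{\mathrm d}(r)$ and $r\eta$ are bounded by a $p_{\mathrm d}$-integrable function of $x$, those of $f_{\mathrm n}(r)$ and $\eta$ by a $p_{\mathrm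 n}$-integrable one; and $U_\eta$ is invertible. **Theorem.** Let $\mathcal P$ be any set of truths, and let $\bar D_f$ be the estimator given by $\bar\eta$ and $f(t)=\bar f_{\mathrm d}(t)+t\bar f_{\mathrm n}(t)$, regular at every $P\in\mathcal P$. Suppose that, for every $P=(\theta,p_{\mathrm n},p_{\mathrm d})\in\mathcal P$, with $\bar c$ and $U_{\bar\eta}$ computed at $P$, $$f(r(x;\theta))-(r(x;\theta)+\rho^{-1})\bigl(\bar f_{\mathrm n}(r(x;\theta))+\bar c^{\,T}U_{\bar\eta}^{-1}\bar\eta(x;\theta)\bigr)\in\mathcal L[\nabla\log r(x;\theta)].$$ Then $\bar D_f$ uniformly attains the minimum asymptotic variance: at every $P\in\mathcal P$, every estimator $\widehat D_f$ that is regular at $P$ (with any $\eta$ and any decomposition of $f$), including $\bar D_f$, has the asymptotic variance $$\sigma^2(\eta,f_{\mathrm d},f_{\mathrm n})=\frac{\rho}{\rho+1}\mathrm V_{\mathrm d}\bigl[f_{\mathrm d}(r)-r\,c^TU_\eta^{-1}\eta\bigr]+\frac1{\rho+1}\mathrm V_{\mathrm n}\bigl[f_{\mathrm n}(r)+c^TU_\eta^{-1}\eta\bigr],$$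 and $\sigma^2(\bar\eta,\bar f_{\mathrm d},\bar f_{\mathrm n})\le\sigma^2(\eta,f_{\mathrm d},f_{\mathrm n})$. -/

import Mathlib

open MeasureTheory ProbabilityTheory Filter Topology Set Matrix

universe u w

noncomputable section

namespace DensityRatio

variable {X : Type u} [MeasurableSpace X] {d : ℕ}

/-- A parametric density-ratio model `r(x;θ)`, `θ ∈ Θ ⊆ ℝ^d`: `Θ` is open, and `r` is positive,
measurable in `x` and continuously differentiable in `θ`. -/
structure IsRatioModel (Θ : Set (Fin d → ℝ)) (r : X → (Fin d → ℝ) → ℝ) : Prop where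
  isOpen : IsOpen Θ
  pos : ∀ x, ∀ θ ∈ Θ, 0 < r x θ
  measurable : ∀ θ ∈ Θ, Measurable fun x => r x θ
  contDiffOn : ∀ x, ContDiffOn ℝ 1 (r x) Θ

/-- The gradient `∇ log r(x;θ)` with respect to `θ`. -/
def gradLog (r : X → (Fin d → ℝ) → ℝ) (θ : Fin d → ℝ) (x : X) : Fin d → ℝ :=
  fun k => fderiv ℝ (fun t => Real.log (r x t)) θ (Pi.single k 1)

/-- The linear space `𝓛[g] = {∑ₖ aₖ gₖ(x) | a ∈ ℝ^d}` of functions on `X`. -/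
def linSpace (g : X → Fin d → ℝ) : Submodule ℝ (X → ℝ) :=
  Submodule.span ℝ (range fun (k : Fin d) (x : X) => g x k)

/-- The generator of an `f`-divergence: strictly convex and differentiable on `(0,∞)`. -/
structure IsGenerator (f : ℝ → ℝ) : Prop where
  strictConvexOn : StrictConvexOn ℝ (Ioi 0) f
  differentiableOn : DifferentiableOn ℝ f (Ioi 0)

/-- The standing assumption on the model and on the divergence. -/
structure ModelAssumption (Θ : Set (Fin d → ℝ)) (r : X → (Fin d → ℝ) → ℝ) (f : ℝ → ℝ) :
    Prop where
  one_mem_model : ∃ θ ∈ Θ, ∀ x, r x θ = 1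
  one_mem_linSpace : ∀ θ ∈ Θ, (fun _ : X => (1 : ℝ)) ∈ linSpace (gradLog r θ)
  f_one : f 1 = 0
  deriv_f_one : deriv f 1 = 0

/-- A candidate for the truth: a parameter `θ` and the distributions `p_n`, `p_d` of the
numerator and of the denominator sample. -/
structure TwoSampleLaw (X : Type u) [MeasurableSpace X] (d : ℕ) where
  θ : Fin d → ℝ
  Pn : Measure X
  Pd : Measure X

/-- `p_n` and `p_d` are probability distributions with `p_n(x) = r(x;θ) p_d(x)`, `θ ∈ Θ`.
The distribution `p_d` is otherwise arbitrary. -/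
structure TwoSampleLaw.InModel (P : TwoSampleLaw X d) (Θ : Set (Fin d → ℝ))
    (r : X → (Fin d → ℝ) → ℝ) : Prop where
  mem : P.θ ∈ Θ
  prob_n : IsProbabilityMeasure P.Pn
  prob_d : IsProbabilityMeasure P.Pd
  ratio : P.Pn = P.Pd.withDensity fun x => ENNReal.ofReal (r x P.θ)

/-- The `f`-divergence `D_f(p_d, p_n) = ∫ p_d f(p_n / p_d)` (for `p_n ≪ p_d`). -/
def fDivergence (f : ℝ → ℝ) (Pd Pn : Measure X) : ℝ :=
  ∫ x, f (Pn.rnDeriv Pd x).toReal ∂Pd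

/-- The choices that determine an estimator of the `f`-divergence: the moment function
`η(x;θ) ∈ ℝ^d` and the two functions `f_d`, `f_n` of a decomposition of `f`. -/
structure Scheme (X : Type u) (d : ℕ) where
  η : X → (Fin d → ℝ) → (Fin d → ℝ)
  fd : ℝ → ℝ
  fn : ℝ → ℝ

/-- The decomposition `f(r) = f_d(r) + r f_n(r)`, `r > 0`. -/
def Scheme.Decomposes (S : Scheme X d) (f : ℝ → ℝ) : Prop :=
  ∀ t : ℝ, 0 < t → f t = S.fd t + t * S.fn t

/-- The matrix `U_η = E_n[η(x;θ) ∇log r(x;θ)ᵀ]`. -/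
def Scheme.U (S : Scheme X d) (r : X → (Fin d → ℝ) → ℝ) (P : TwoSampleLaw X d) :
    Matrix (Fin d) (Fin d) ℝ :=
  Matrix.of fun i j => ∫ x, S.η x P.θ i * gradLog r P.θ x j ∂P.Pn

/-- The vector `c = E_n[{f'(r(x;θ)) - f_n(r(x;θ))} ∇log r(x;θ)]`. -/
def Scheme.c (S : Scheme X d) (r : X → (Fin d → ℝ) → ℝ) (f : ℝ → ℝ) (P : TwoSampleLaw X d) :
    Fin d → ℝ :=
  fun j => ∫ x, (deriv f (r x P.θ) - S.fn (r x P.θ)) * gradLog r P.θ x j ∂P.Pn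

/-- The function `x ↦ cᵀ U_η⁻¹ η(x;θ)`. -/
def Scheme.cUη (S : Scheme X d) (r : X → (Fin d → ℝ) → ℝ) (f : ℝ → ℝ) (P : TwoSampleLaw X d)
    (x : X) : ℝ :=
  S.c r f P ⬝ᵥ ((S.U r P)⁻¹ *ᵥ S.η x P.θ)

/-- Near `θ₀`, the `θ`-derivative of `g(x;θ)` is bounded by a `μ`-integrable function of `x`. -/
def DominatedDeriv (μ : Measure X) (g : X → (Fin d → ℝ) → ℝ) (θ₀ : Fin d → ℝ) : Prop :=
  ∃ V ∈ 𝓝 θ₀, ∃ K : X → ℝ, Integrable K μ ∧ ∀ x, ∀ θ ∈ V, ‖fderiv ℝ (g x) θ‖ ≤ K x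

/-- The usual regularity conditions, under which the estimator given by `S` is asymptotically
normal when the truth is `P`: smoothness, finite second moments, domination of the first
derivatives near the true parameter, and non-degeneracy of `U_η`. -/
structure Scheme.Regular (S : Scheme X d) (Θ : Set (Fin d → ℝ)) (r : X → (Fin d → ℝ) → ℝ)
    (P : TwoSampleLaw X d) : Prop where
  contDiffOn_fd : ContDiffOn ℝ 1 S.fd (Ioi 0)
  contDiffOn_fn : ContDiffOn ℝ 1 S.fn (Ioi 0)
  measurable_η : ∀ θ ∈ Θ, Measurable fun x => S.η x θ
  contDiffOn_η : ∀ x, ContDiffOn ℝ 1 (S.η x) Θ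
  memLp_fd : MemLp (fun x => S.fd (r x P.θ)) 2 P.Pd
  memLp_fn : MemLp (fun x => S.fn (r x P.θ)) 2 P.Pn
  memLp_η_d : ∀ i, MemLp (fun x => r x P.θ * S.η x P.θ i) 2 P.Pd
  memLp_η_n : ∀ i, MemLp (fun x => S.η x P.θ i) 2 P.Pn
  dominated_fd : DominatedDeriv P.Pd (fun x θ => S.fd (r x θ)) P.θ
  dominated_fn : DominatedDeriv P.Pn (fun x θ => S.fn (r x θ)) P.θ
  dominated_η_d : ∀ i, DominatedDeriv P.Pd (fun x θ => r x θ * S.η x θ i) P.θ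
  dominated_η_n : ∀ i, DominatedDeriv P.Pn (fun x θ => S.η x θ i) P.θ
  nondegenerate : IsUnit (S.U r P).det

/-- The estimating function `Q_η(θ)` of `m_n` numerator points `yn 0, yn 1, …` and `m_d`
denominator points `yd 0, yd 1, …`. -/
def Scheme.Q (S : Scheme X d) (r : X → (Fin d → ℝ) → ℝ) (mn md : ℕ) (yn yd : ℕ → X)
    (θ : Fin d → ℝ) : Fin d → ℝ :=
  (md : ℝ)⁻¹ • ∑ i ∈ Finset.range md, r (yd i) θ • S.η (yd i) θ
    - (mn : ℝ)⁻¹ • ∑ j ∈ Finset.range mn, S.η (yn j) θ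

/-- The estimate of the `f`-divergence for the parameter value `θ`. -/
def Scheme.estimate (S : Scheme X d) (r : X → (Fin d → ℝ) → ℝ) (mn md : ℕ) (yn yd : ℕ → X)
    (θ : Fin d → ℝ) : ℝ :=
  (md : ℝ)⁻¹ * ∑ i ∈ Finset.range md, S.fd (r (yd i) θ)
    + (mn : ℝ)⁻¹ * ∑ j ∈ Finset.range mn, S.fn (r (yn j) θ)

/-- `m = m_n m_d / (m_n + m_d)`. -/
def effSize (mn md : ℕ) : ℝ := (mn * md : ℝ) / (mn + md : ℝ)

/-- `xn` are i.i.d. from `p_n`, `xd` are i.i.d. from `p_d`, and the two samples are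
independent. -/
structure IsTwoSample (P : TwoSampleLaw X d) {Ω : Type w} [MeasurableSpace Ω] (μ : Measure Ω)
    (xn xd : ℕ → Ω → X) : Prop where
  measurable_n : ∀ i, Measurable (xn i)
  measurable_d : ∀ i, Measurable (xd i)
  law_n : ∀ i, μ.map (xn i) = P.Pn
  law_d : ∀ i, μ.map (xd i) = P.Pd
  indep : iIndepFun (Sum.elim xn xd) μ

/-- The sample sizes `m_n`, `m_d` tend to infinity and `m_n / m_d` tends to `ρ`. -/
structure IsSampling (ρ : ℝ) (mn md : ℕ → ℕ) : Prop where
  tendsto_n : Tendsto mn atTop atTop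
  tendsto_d : Tendsto md atTop atTop
  ratio : Tendsto (fun k => (mn k : ℝ) / (md k : ℝ)) atTop (𝓝 ρ)

/-- `θhat` is a moment matching estimator: a measurable `Θ`-valued and consistent sequence that
solves the estimating equation `Q_η(θhat) = 0` with probability tending to one. -/
structure Scheme.IsMomentMatching (S : Scheme X d) (Θ : Set (Fin d → ℝ))
    (r : X → (Fin d → ℝ) → ℝ) (P : TwoSampleLaw X d) {Ω : Type w} [MeasurableSpace Ω]
    (μ : Measure Ω) (xn xd : ℕ → Ω → X) (mn md : ℕ → ℕ) (θhat : ℕ → Ω → Fin d → ℝ) : Prop where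
  measurable : ∀ k, Measurable (θhat k)
  mem : ∀ k ω, θhat k ω ∈ Θ
  root : Tendsto (fun k => μ {ω | S.Q r (mn k) (md k) (fun i => xn i ω) (fun i => xd i ω)
    (θhat k ω) ≠ 0}) atTop (𝓝 0)
  consistent : TendstoInMeasure μ θhat atTop fun _ => P.θ

/-- `v` is the asymptotic variance of the estimator of `D_f(p_d, p_n)` given by `S`: whenever
`θhat` is a moment matching estimator from two independent samples, whose sizes have limiting
ratio `ρ`, the error `√m (D̂_f - D_f)` converges in law to the normal distribution `N(0, v)`. -/
def Scheme.HasAsymptoticVariance (S : Scheme X d) (Θ : Set (Fin d → ℝ))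
    (r : X → (Fin d → ℝ) → ℝ) (f : ℝ → ℝ) (ρ : ℝ) (P : TwoSampleLaw X d) (v : ℝ) : Prop :=
  0 ≤ v ∧
  ∀ (Ω : Type w) [MeasurableSpace Ω] (μ : Measure Ω) [IsProbabilityMeasure μ]
    (xn xd : ℕ → Ω → X) (mn md : ℕ → ℕ) (θhat : ℕ → Ω → Fin d → ℝ),
    IsTwoSample P μ xn xd → IsSampling ρ mn md →
    S.IsMomentMatching Θ r P μ xn xd mn md θhat →
    TendstoInDistribution
      (fun k ω => √(effSize (mn k) (md k)) *
        (S.estimate r (mn k) (md k) (fun i => xn i ω) (fun i => xd i ω) (θhat k ω)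
          - fDivergence f P.Pd P.Pn))
      atTop (id : ℝ → ℝ) (fun _ => μ) (gaussianReal 0 v.toNNReal)

/-- The (limiting) variance of the leading term `ℙf - √m cᵀ U_η⁻¹ Q_η` of `√m (D̂_f - D_f)`. -/
def Scheme.leadingVariance (S : Scheme X d) (r : X → (Fin d → ℝ) → ℝ) (f : ℝ → ℝ) (ρ : ℝ)
    (P : TwoSampleLaw X d) : ℝ :=
  ρ / (ρ + 1) * Var[fun x => S.fd (r x P.θ) - r x P.θ * S.cUη r f P x; P.Pd]
    + 1 / (ρ + 1) * Var[fun x => S.fn (r x P.θ) + S.cUη r f P x; P.Pn]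

end DensityRatio

end

noncomputable section

namespace DensityRatio

open Asymptotics

/-! Asymptotic variance. Write e = θ̂ - θ. Expanding `Q` and the plug-in estimate to first order in
e gives expected derivatives `U` and `c`. Since Q(θ̂) = 0 with probability tending to one, Q(θ) + U
e = o(e). As `U` is invertible, e = O(Q(θ)), and cᵀe may be replaced by -cᵀU⁻¹Q(θ) up to o(Q(θ)). So
D̂ is, up to o(Q(θ)), a mean of `influenceD` over the denominator sample plus a mean of `influenceN`
over the numerator sample (`estimate_linearization`). The rest is the two-sample central limit
theorem and Slutsky.

Only first derivatives are dominated, so no second-order Taylor bound is available.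
`empMean_sub_isLittleO` uses instead the supremum of the relative linearization error over a small
ball: its mean tends to zero with the radius by dominated convergence, and the law of large numbers
carries this over to the sample, uniformly in the ball and hence at the random θ̂.

Optimality. Write φ for `influenceN`; then `influenceD` is f(r) - rφ, so the variance depends on the
scheme through φ alone. For two regular schemes let δ be the difference of their φ. From E_n[cᵀU⁻¹η
∇log r] = c and the definition of `c`, δ is orthogonal under p_n to every function in 𝓛[∇log r]
(`integral_influence_sub_mul`). As 1 lies in this space, δ has p_n-mean zero and rδ has p_d-mean
zero. Expanding the variance of φ̄ + δ, the cross term is a multiple of E_n[{f(r) - (r + ρ⁻¹)φ̄}δ],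
which vanishes by the assumed condition. What remains is a nonnegative combination of the variances
of rδ and δ. -/

/-- The filter of the sets of pairs `(k, ω)` which hold with probability tending to one. -/
def inProb {Ω : Type*} [MeasurableSpace Ω] (μ : Measure Ω) : Filter (ℕ × Ω) where
  sets := {s | Tendsto (fun k => μ {ω | (k, ω) ∉ s}) atTop (𝓝 0)}
  univ_sets := by simp
  sets_of_superset := by
    intro s t hs hst
    refine tendsto_of_tendsto_of_tendsto_of_le_of_le tendsto_const_nhds hs
      (fun _ => zero_le) (fun k => measure_mono ?_)
    intro ω hω h
    exact hω (hst h)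
  inter_sets := by
    intro s t hs ht
    have := Tendsto.add hs ht
    rw [add_zero] at this
    refine tendsto_of_tendsto_of_tendsto_of_le_of_le tendsto_const_nhds this
      (fun _ => zero_le) (fun k => (measure_mono ?_).trans (measure_union_le _ _))
    intro ω hω
    by_cases h : (k, ω) ∈ s
    · exact Or.inr fun h' => hω ⟨h, h'⟩
    · exact Or.inl h

/-! ### Stochastic order symbols -/

section InProb

variable {Ω : Type*} [MeasurableSpace Ω] {μ : Measure Ω}

theorem eventually_inProb {p : ℕ × Ω → Prop} :
    (∀ᶠ q in inProb μ, p q) ↔ Tendsto (fun k => μ {ω | ¬ p (k, ω)}) atTop (𝓝 0) := Iff.rfl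

/-- With this dictionary, `=o[inProb μ]` and `=O[inProb μ]` serve as stochastic order relations, and
the general asymptotic calculus applies to them. -/
theorem tendsto_inProb_iff {E : Type*} [SeminormedAddCommGroup E] {f : ℕ → Ω → E} {c : E} :
    Tendsto (fun q : ℕ × Ω => f q.1 q.2) (inProb μ) (𝓝 c) ↔
      TendstoInMeasure μ f atTop fun _ => c := by
  rw [tendstoInMeasure_iff_norm, Metric.tendsto_nhds]
  simp only [eventually_inProb, dist_eq_norm, not_lt]

theorem tendsto_inProb_of_ae [IsFiniteMeasure μ] {f : ℕ → Ω → ℝ} {c : ℝ}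
    (hf : ∀ n, AEStronglyMeasurable (f n) μ)
    (hfc : ∀ᵐ ω ∂μ, Tendsto (fun n => f n ω) atTop (𝓝 c)) :
    Tendsto (fun q : ℕ × Ω => f q.1 q.2) (inProb μ) (𝓝 c) :=
  tendsto_inProb_iff.2 (tendstoInMeasure_of_tendsto_ae hf hfc)

/-- Boundedness in probability (uniform tightness) of a sequence of random vectors. -/
def BoundedInProb {E : Type*} [Norm E] (μ : Measure Ω) (T : ℕ → Ω → E) : Prop :=
  ∀ ε > 0, ∃ C : ℝ, ∀ k, μ {ω | C < ‖T k ω‖} ≤ ε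

/-- Characteristic functions converge pointwise to that of a probability measure, which is
continuous at 0; this forces tightness. -/
theorem BoundedInProb.of_tendstoInDistribution [IsProbabilityMeasure μ] {T : ℕ → Ω → ℝ}
    {ν : Measure ℝ} [IsProbabilityMeasure ν]
    (hT : TendstoInDistribution T atTop (id : ℝ → ℝ) (fun _ => μ) ν) : BoundedInProb μ T := by
  have htight : IsTightMeasureSet (Set.range fun n => μ.map (T n)) := by
    have := fun n => Measure.isProbabilityMeasure_map (hT.forall_aemeasurable n)
    refine isTightMeasureSet_of_tendsto_charFun (f := charFun ν) (by fun_prop) fun t => ?_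
    have := ProbabilityMeasure.tendsto_iff_tendsto_charFun.1 hT.tendsto t
    simpa using this
  rw [isTightMeasureSet_iff_tendsto_measure_norm_gt] at htight
  intro ε hε
  obtain ⟨C, hC⟩ := ((ENNReal.tendsto_nhds_zero.1 htight) _ hε).exists
  refine ⟨C, fun k => ?_⟩
  refine le_trans ?_ (le_trans (le_iSup₂ (f := fun (ν : Measure ℝ) (_ : ν ∈ Set.range
    fun n => μ.map (T n)) => ν {x | C < ‖x‖}) (μ.map (T k)) ⟨k, rfl⟩) hC)
  rw [Measure.map_apply_of_aemeasurable (hT.forall_aemeasurable k)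
    (measurableSet_lt measurable_const measurable_norm)]
  rfl

theorem BoundedInProb.pi {d : ℕ} {T : ℕ → Ω → Fin d → ℝ}
    (hT : ∀ i, BoundedInProb μ fun k ω => T k ω i) : BoundedInProb μ T := by
  intro ε hε
  -- Dividing by d + 1 instead of d covers d = 0.
  have hε' : 0 < ε / (d + 1) := ENNReal.div_pos hε.ne' (by finiteness)
  choose C hC using fun i => hT i _ hε'
  refine ⟨∑ i, |C i|, fun k => ?_⟩
  have hsub : {ω | ∑ i, |C i| < ‖T k ω‖} ⊆ ⋃ i, {ω | C i < ‖T k ω i‖} := by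
    intro ω hω
    by_contra hcon
    simp only [mem_iUnion, mem_ofPred_eq, not_exists, not_lt] at hcon hω
    refine absurd ((pi_norm_le_iff_of_nonneg (by positivity)).2 fun i => ?_) hω.not_ge
    exact (hcon i).trans ((le_abs_self _).trans
      (Finset.single_le_sum (f := fun i => |C i|) (fun _ _ => abs_nonneg _) (Finset.mem_univ i)))
  calc μ {ω | ∑ i, |C i| < ‖T k ω‖} ≤ ∑ i, μ {ω | C i < ‖T k ω i‖} :=
        (measure_mono hsub).trans (measure_iUnion_fintype_le _ _)
    _ ≤ ∑ _i : Fin d, ε / (d + 1) := Finset.sum_le_sum fun i _ => hC i k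
    _ = d * (ε / (d + 1)) := by simp
    _ ≤ (d + 1) * (ε / (d + 1)) := by gcongr; exact le_self_add
    _ ≤ ε := ENNReal.mul_div_le

/-- Off two events of small probability, T is bounded by a constant and R by a small multiple of T.
-/
theorem BoundedInProb.tendsto_zero_of_isLittleO {E : Type*} [SeminormedAddCommGroup E]
    {T : ℕ → Ω → E} {R : ℕ → Ω → ℝ} (hT : BoundedInProb μ T)
    (hR : (fun q : ℕ × Ω => R q.1 q.2) =o[inProb μ] fun q : ℕ × Ω => T q.1 q.2) :
    Tendsto (fun q : ℕ × Ω => R q.1 q.2) (inProb μ) (𝓝 0) := by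
  rw [Metric.tendsto_nhds]
  intro η hη
  rw [eventually_inProb, ENNReal.tendsto_nhds_zero]
  intro ε hε
  have hε2 : 0 < ε / 2 := ENNReal.div_pos hε.ne' (by simp)
  obtain ⟨C, hC⟩ := hT _ hε2
  have hδ : 0 < η / (|C| + 1) := by positivity
  have hb := eventually_inProb.1 (hR.def hδ)
  filter_upwards [(ENNReal.tendsto_nhds_zero.1 hb) _ hε2] with k hk
  calc μ {ω | ¬ dist (R k ω) 0 < η}
      ≤ μ ({ω | ¬ ‖R k ω‖ ≤ η / (|C| + 1) * ‖T k ω‖} ∪ {ω | C < ‖T k ω‖}) := by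
        refine measure_mono fun ω hω => ?_
        by_contra hcon
        simp only [mem_union, mem_ofPred_eq, not_or, not_not, not_lt] at hcon
        apply hω
        rw [dist_zero_right]
        calc ‖R k ω‖ ≤ η / (|C| + 1) * ‖T k ω‖ := hcon.1
          _ ≤ η / (|C| + 1) * |C| := by gcongr; exact hcon.2.trans (le_abs_self C)
          _ < η / (|C| + 1) * (|C| + 1) := by gcongr; linarith
          _ = η := by field_simp
    _ ≤ ε / 2 + ε / 2 := (measure_union_le _ _).trans (add_le_add hk (hC k))
    _ = ε := ENNReal.add_halves ε

end InProb

/-! ### Empirical means and the law of large numbers -/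

section IID

variable {X : Type u} [MeasurableSpace X] {Ω : Type w} [MeasurableSpace Ω] {μ : Measure Ω}
  [IsProbabilityMeasure μ] {ν : Measure X}

/-- The empirical mean of `g` over the first `n` points of `y`. -/
def empMean (n : ℕ) (y : ℕ → X) (g : X → ℝ) : ℝ := (n : ℝ)⁻¹ * ∑ i ∈ Finset.range n, g (y i)

omit [MeasurableSpace X] in
theorem empMean_add (n : ℕ) (y : ℕ → X) (g h : X → ℝ) :
    empMean n y (fun x => g x + h x) = empMean n y g + empMean n y h := by
  simp [empMean, Finset.sum_add_distrib, mul_add]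

omit [MeasurableSpace X] in
theorem empMean_sub (n : ℕ) (y : ℕ → X) (g h : X → ℝ) :
    empMean n y (fun x => g x - h x) = empMean n y g - empMean n y h := by
  simp [empMean, Finset.sum_sub_distrib, mul_sub]

omit [MeasurableSpace X] in
theorem empMean_mul_const (n : ℕ) (y : ℕ → X) (g : X → ℝ) (c : ℝ) :
    empMean n y (fun x => g x * c) = empMean n y g * c := by
  simp [empMean, ← Finset.sum_mul, mul_assoc]

omit [MeasurableSpace X] in
theorem empMean_const_mul (n : ℕ) (y : ℕ → X) (g : X → ℝ) (c : ℝ) :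
    empMean n y (fun x => c * g x) = c * empMean n y g := by
  simp only [mul_comm c, empMean_mul_const]

omit [MeasurableSpace X] in
theorem empMean_sum {ι : Type*} (s : Finset ι) (n : ℕ) (y : ℕ → X) (g : ι → X → ℝ) :
    empMean n y (fun x => ∑ k ∈ s, g k x) = ∑ k ∈ s, empMean n y (g k) := by
  simp only [empMean, ← Finset.mul_sum]
  rw [Finset.sum_comm]

omit [MeasurableSpace X] in
theorem abs_empMean_le (n : ℕ) (y : ℕ → X) {g h : X → ℝ} (hgh : ∀ x, |g x| ≤ h x) :
    |empMean n y g| ≤ empMean n y h := by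
  rw [empMean, empMean, abs_mul, abs_of_nonneg (by positivity : (0 : ℝ) ≤ (n : ℝ)⁻¹)]
  gcongr
  exact (Finset.abs_sum_le_sum_abs _ _).trans (Finset.sum_le_sum fun i _ => hgh _)

theorem measurable_empMean (n : ℕ) {y : ℕ → Ω → X} (hy : ∀ i, Measurable (y i)) {g : X → ℝ}
    (hg : Measurable g) : Measurable fun ω => empMean n (fun i => y i ω) g := by
  unfold empMean
  have := fun i => hg.comp (hy i)
  simp only [Function.comp_def] at this
  fun_prop

variable {y : ℕ → Ω → X} {n : ℕ → ℕ}

/-- The law of large numbers for an i.i.d. sample of growing size. -/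
theorem tendsto_empMean (hy : ∀ i, Measurable (y i)) (hlaw : ∀ i, μ.map (y i) = ν)
    (hind : iIndepFun y μ) (hn : Tendsto n atTop atTop) {g : X → ℝ} (hg : Measurable g)
    (hint : Integrable g ν) :
    Tendsto (fun q : ℕ × Ω => empMean (n q.1) (fun i => y i q.2) g) (inProb μ)
      (𝓝 (∫ x, g x ∂ν)) := by
  refine tendsto_inProb_of_ae
    (f := fun k ω => empMean (n k) (fun i => y i ω) g)
    (fun k => (measurable_empMean _ hy hg).aestronglyMeasurable) ?_
  have hident : ∀ i, IdentDistrib (y i) (y 0) μ μ := fun i =>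
    ⟨(hy i).aemeasurable, (hy 0).aemeasurable, by rw [hlaw, hlaw]⟩
  have h0 : Integrable (fun ω => g (y 0 ω)) μ := by
    rw [← hlaw 0] at hint
    exact hint.comp_measurable (hy 0)
  have := strong_law_ae (μ := μ) (fun i ω => g (y i ω)) h0
    (fun i j hij => (hind.indepFun hij).comp hg hg) (fun i => (hident i).comp hg)
  have hE : ∫ ω, g (y 0 ω) ∂μ = ∫ x, g x ∂ν := by
    rw [← hlaw 0, integral_map (hy 0).aemeasurable hg.aestronglyMeasurable]
  filter_upwards [this] with ω hω
  rw [hE] at hω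
  exact hω.comp hn

end IID

/-! ### Uniform linearization of empirical means -/

section Expansion

variable {X : Type u} [MeasurableSpace X] {d : ℕ}

theorem clm_apply_eq_sum (D : (Fin d → ℝ) →L[ℝ] ℝ) (v : Fin d → ℝ) :
    D v = ∑ k, D (Pi.single k 1) * v k := by
  conv_lhs => rw [← Finset.univ_sum_single v]
  rw [map_sum]
  refine Finset.sum_congr rfl fun k _ => ?_
  have : Pi.single k (v k) = v k • (Pi.single k 1 : Fin d → ℝ) := by
    ext j; by_cases h : j = k
    · subst h; simp
    · simp [h]
  rw [this, map_smul, smul_eq_mul, mul_comm]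

/-- A directional derivative of a function that is measurable for each parameter value is
measurable. -/
theorem measurable_fderiv_apply {Θ : Set (Fin d → ℝ)} (hΘ : IsOpen Θ) {θ₀ : Fin d → ℝ}
    (h₀ : θ₀ ∈ Θ) {g : X → (Fin d → ℝ) → ℝ} (hmeas : ∀ θ ∈ Θ, Measurable fun x => g x θ)
    (hdiff : ∀ x, DifferentiableAt ℝ (g x) θ₀) (v : Fin d → ℝ) :
    Measurable fun x => fderiv ℝ (g x) θ₀ v := by
  have hlim : Tendsto (fun j : ℕ => θ₀ + ((j : ℝ) + 1)⁻¹ • v) atTop (𝓝 θ₀) := by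
    have h1 : Tendsto (fun j : ℕ => ((j : ℝ) + 1)⁻¹) atTop (𝓝 0) := by
      simpa using tendsto_one_div_add_atTop_nhds_zero_nat (𝕜 := ℝ)
    have := (h1.smul_const v).const_add θ₀
    simpa using this
  -- Measurability is known only for parameters in Θ, so the difference quotients start where the
  -- points have entered Θ.
  obtain ⟨N, hN⟩ := eventually_atTop.1 (hlim.eventually (hΘ.mem_nhds h₀))
  refine measurable_of_tendsto_metrizable
    (f := fun (j : ℕ) x => ((j + N : ℕ) + 1 : ℝ) *
      (g x (θ₀ + (((j + N : ℕ) : ℝ) + 1)⁻¹ • v) - g x θ₀)) (fun j => ?_) ?_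
  · exact measurable_const.mul ((hmeas _ (hN _ (by omega))).sub (hmeas _ h₀))
  · rw [tendsto_pi_nhds]
    intro x
    have hc : Tendsto (fun j : ℕ => ‖(((j + N : ℕ) : ℝ) + 1)‖) atTop atTop := by
      refine tendsto_norm_atTop_atTop.comp ?_
      exact tendsto_atTop_add_const_right _ _
        (tendsto_natCast_atTop_atTop.comp (tendsto_add_atTop_nat N))
    simpa using (hdiff x).hasFDerivAt.lim v hc

/-- The largest relative linearization error of `g x` in the ball of radius `ε` about `θ₀`. -/
def linModulus (g : X → (Fin d → ℝ) → ℝ) (θ₀ : Fin d → ℝ) (ε : ℝ) (x : X) : ℝ :=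
  ⨆ j : ℕ, (Metric.ball θ₀ ε).indicator (fun θ =>
    |g x θ - g x θ₀ - fderiv ℝ (g x) θ₀ (θ - θ₀)| / ‖θ - θ₀‖) (TopologicalSpace.denseSeq _ j)

variable {g : X → (Fin d → ℝ) → ℝ} {θ₀ : Fin d → ℝ} {ε B : ℝ} {x : X}

omit [MeasurableSpace X] in
theorem linModulus_nonneg : 0 ≤ linModulus g θ₀ ε x :=
  Real.iSup_nonneg fun _ => indicator_nonneg (fun _ _ => by positivity) _

omit [MeasurableSpace X] in
theorem indicator_linError_le (hB : 0 ≤ B)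
    (h : ∀ θ ∈ Metric.ball θ₀ ε,
      |g x θ - g x θ₀ - fderiv ℝ (g x) θ₀ (θ - θ₀)| ≤ B * ‖θ - θ₀‖) (θ : Fin d → ℝ) :
    (Metric.ball θ₀ ε).indicator (fun θ =>
      |g x θ - g x θ₀ - fderiv ℝ (g x) θ₀ (θ - θ₀)| / ‖θ - θ₀‖) θ ≤ B :=
  indicator_apply_le' (fun hθ => div_le_of_le_mul₀ (norm_nonneg _) hB (h θ hθ)) (fun _ => hB)

omit [MeasurableSpace X] in
theorem linModulus_le (hB : 0 ≤ B)
    (h : ∀ θ ∈ Metric.ball θ₀ ε,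
      |g x θ - g x θ₀ - fderiv ℝ (g x) θ₀ (θ - θ₀)| ≤ B * ‖θ - θ₀‖) :
    linModulus g θ₀ ε x ≤ B :=
  ciSup_le fun _ => indicator_linError_le hB h _

omit [MeasurableSpace X] in
-- The supremum runs over a dense sequence only, which keeps it measurable; continuity of `g x`
-- extends the bound to the whole ball.
theorem linError_le_linModulus (hB : 0 ≤ B)
    (h : ∀ θ ∈ Metric.ball θ₀ ε,
      |g x θ - g x θ₀ - fderiv ℝ (g x) θ₀ (θ - θ₀)| ≤ B * ‖θ - θ₀‖)
    (hcont : ContinuousOn (g x) (Metric.ball θ₀ ε)) {θ : Fin d → ℝ}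
    (hθ : θ ∈ Metric.ball θ₀ ε) :
    |g x θ - g x θ₀ - fderiv ℝ (g x) θ₀ (θ - θ₀)| ≤ linModulus g θ₀ ε x * ‖θ - θ₀‖ := by
  have hbdd : BddAbove (range fun j : ℕ => (Metric.ball θ₀ ε).indicator (fun θ =>
      |g x θ - g x θ₀ - fderiv ℝ (g x) θ₀ (θ - θ₀)| / ‖θ - θ₀‖)
        (TopologicalSpace.denseSeq (Fin d → ℝ) j)) :=
    ⟨B, by rintro _ ⟨j, rfl⟩; exact indicator_linError_le hB h _⟩
  have hcl := (TopologicalSpace.denseRange_denseSeq (Fin d → ℝ)).open_subset_closure_inter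
    (Metric.isOpen_ball (x := θ₀) (ε := ε)) hθ
  rw [mem_closure_iff_seq_limit] at hcl
  obtain ⟨s, hs, hlim⟩ := hcl
  have hlim' : Tendsto s atTop (𝓝[Metric.ball θ₀ ε] θ) :=
    tendsto_nhdsWithin_iff.2 ⟨hlim, Eventually.of_forall fun k => (hs k).1⟩
  have hg := (hcont θ hθ).tendsto.comp hlim'
  have hsub : Tendsto (fun k => s k - θ₀) atTop (𝓝 (θ - θ₀)) := hlim.sub_const _
  have hD := ((fderiv ℝ (g x) θ₀).continuous.tendsto (θ - θ₀)).comp hsub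
  refine le_of_tendsto_of_tendsto ((hg.sub_const (g x θ₀)).sub hD).abs
    (hsub.norm.const_mul (linModulus g θ₀ ε x)) (Eventually.of_forall fun k => ?_)
  obtain ⟨hk, j, hj⟩ := hs k
  have := le_ciSup hbdd j
  simp only [hj, indicator_of_mem hk] at this
  -- At θ₀ the quotient is 0/0 = 0 and carries no information; there the error vanishes by `h`.
  rcases (norm_nonneg (s k - θ₀)).eq_or_lt with h0 | h0
  · have := h _ hk
    rw [← h0, mul_zero] at this
    simpa [← h0] using this
  · exact (div_le_iff₀ h0).1 this

theorem measurable_linModulus {Θ : Set (Fin d → ℝ)} (hΘ : IsOpen Θ) (h₀ : θ₀ ∈ Θ)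
    (hmeas : ∀ θ ∈ Θ, Measurable fun x => g x θ) (hdiff : ∀ x, DifferentiableAt ℝ (g x) θ₀)
    (hball : Metric.ball θ₀ ε ⊆ Θ) : Measurable (linModulus g θ₀ ε) := by
  refine Measurable.iSup fun j => ?_
  by_cases hj : TopologicalSpace.denseSeq (Fin d → ℝ) j ∈ Metric.ball θ₀ ε
  · simp only [indicator_of_mem hj]
    have := measurable_fderiv_apply hΘ h₀ hmeas hdiff
      (TopologicalSpace.denseSeq (Fin d → ℝ) j - θ₀)
    exact ((((hmeas _ (hball hj)).sub (hmeas _ h₀)).sub this).abs).div_const _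
  · simp only [indicator_of_notMem hj]
    exact measurable_const

omit [MeasurableSpace X] in
-- One K comes from the mean value inequality, the other from the linear term.
theorem linError_le_of_norm_fderiv_le {K : ℝ}
    (hdiff : ∀ θ ∈ Metric.ball θ₀ ε, DifferentiableAt ℝ (g x) θ)
    (hK : ∀ θ ∈ Metric.ball θ₀ ε, ‖fderiv ℝ (g x) θ‖ ≤ K) (θ : Fin d → ℝ)
    (hθ : θ ∈ Metric.ball θ₀ ε) :
    |g x θ - g x θ₀ - fderiv ℝ (g x) θ₀ (θ - θ₀)| ≤ 2 * K * ‖θ - θ₀‖ := by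
  have h₀ : θ₀ ∈ Metric.ball θ₀ ε := Metric.mem_ball_self (Metric.pos_of_mem_ball hθ)
  have h1 := (convex_ball θ₀ ε).norm_image_sub_le_of_norm_fderiv_le hdiff hK h₀ hθ
  have h2 := (fderiv ℝ (g x) θ₀).le_of_opNorm_le (hK _ h₀) (θ - θ₀)
  rw [Real.norm_eq_abs] at h1 h2
  calc _ ≤ |g x θ - g x θ₀| + |fderiv ℝ (g x) θ₀ (θ - θ₀)| := abs_sub _ _
    _ ≤ _ := by linarith

/-- The expected linearization modulus of a dominated function tends to zero with the radius. -/
theorem exists_linModulus_lt {Θ : Set (Fin d → ℝ)} (hΘ : IsOpen Θ) (h₀ : θ₀ ∈ Θ) {ν : Measure X}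
    (hmeas : ∀ θ ∈ Θ, Measurable fun x => g x θ) (hC : ∀ x, ContDiffOn ℝ 1 (g x) Θ)
    (hdom : DominatedDeriv ν g θ₀) {δ : ℝ} (hδ : 0 < δ) :
    ∃ ε > 0, Measurable (linModulus g θ₀ ε) ∧ Integrable (linModulus g θ₀ ε) ν ∧
      ∫ x, linModulus g θ₀ ε x ∂ν < δ ∧ ∀ x, ∀ θ ∈ Metric.ball θ₀ ε,
        |g x θ - g x θ₀ - fderiv ℝ (g x) θ₀ (θ - θ₀)| ≤ linModulus g θ₀ ε x * ‖θ - θ₀‖ := by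
  obtain ⟨V, hV, K, hKint, hK⟩ := hdom
  obtain ⟨ε₀, hε₀, hball⟩ := Metric.mem_nhds_iff.1 (inter_mem hV (hΘ.mem_nhds h₀))
  have hdiff : ∀ x, ∀ θ ∈ Θ, DifferentiableAt ℝ (g x) θ := fun x θ hθ =>
    ((hC x).differentiableOn one_ne_zero).differentiableAt (hΘ.mem_nhds hθ)
  have hK0 : ∀ x, 0 ≤ 2 * K x := fun x =>
    mul_nonneg zero_le_two ((norm_nonneg _).trans (hK x θ₀ (mem_of_mem_nhds hV)))
  have hb : ∀ ε ≤ ε₀, ∀ x, ∀ θ ∈ Metric.ball θ₀ ε,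
      |g x θ - g x θ₀ - fderiv ℝ (g x) θ₀ (θ - θ₀)| ≤ 2 * K x * ‖θ - θ₀‖ := by
    intro ε hε x
    refine linError_le_of_norm_fderiv_le (fun θ hθ => ?_) (fun θ hθ => ?_)
    · exact hdiff x θ (hball (Metric.ball_subset_ball hε hθ)).2
    · exact hK x θ (hball (Metric.ball_subset_ball hε hθ)).1
  have hm : ∀ ε ≤ ε₀, Measurable (linModulus g θ₀ ε) := fun ε hε =>
    measurable_linModulus hΘ h₀ hmeas (fun x => hdiff x _ h₀)
      fun θ hθ => (hball (Metric.ball_subset_ball hε hθ)).2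
  have hle : ∀ ε ≤ ε₀, ∀ x, ‖linModulus g θ₀ ε x‖ ≤ 2 * K x := fun ε hε x => by
    rw [Real.norm_eq_abs, abs_of_nonneg linModulus_nonneg]
    exact linModulus_le (hK0 x) (hb ε hε x)
  have hint : Integrable (fun x => 2 * K x) ν := hKint.const_mul 2
  have hev : ∀ᶠ ε in 𝓝[>] (0 : ℝ), ε ≤ ε₀ :=
    nhdsWithin_le_nhds (eventually_le_nhds hε₀)
  have hlim : Tendsto (fun ε => ∫ x, linModulus g θ₀ ε x ∂ν) (𝓝[>] (0 : ℝ))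
      (𝓝 (∫ _, (0 : ℝ) ∂ν)) := by
    refine tendsto_integral_filter_of_dominated_convergence (fun x => 2 * K x) ?_ ?_ hint ?_
    · filter_upwards [hev] with ε hε using (hm ε hε).aestronglyMeasurable
    · filter_upwards [hev] with ε hε using Eventually.of_forall (hle ε hε)
    -- Pointwise convergence is differentiability at θ₀: the relative error is at most η/2 on a
    -- small enough ball.
    · refine Eventually.of_forall fun x => Metric.tendsto_nhds.2 fun η hη => ?_
      have hd := (hdiff x θ₀ h₀).hasFDerivAt.isLittleO.def (half_pos hη)
      obtain ⟨ε₁, hε₁, hsub⟩ := Metric.mem_nhds_iff.1 hd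
      have : ∀ᶠ ε in 𝓝[>] (0 : ℝ), ε ≤ ε₁ := nhdsWithin_le_nhds (eventually_le_nhds hε₁)
      filter_upwards [this] with ε hε
      rw [dist_zero_right, Real.norm_eq_abs, abs_of_nonneg linModulus_nonneg]
      refine lt_of_le_of_lt (linModulus_le (half_pos hη).le fun θ hθ => ?_) (half_lt_self hη)
      exact hsub (Metric.ball_subset_ball hε hθ)
  rw [integral_zero] at hlim
  obtain ⟨ε, hε, hεle, hlt⟩ :=
    (eventually_mem_nhdsWithin.and (hev.and (hlim.eventually_lt_const hδ))).exists
  refine ⟨ε, hε, hm ε hεle, hint.mono' (hm ε hεle).aestronglyMeasurable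
    (Eventually.of_forall (hle ε hεle)), hlt, fun x θ hθ => ?_⟩
  refine linError_le_linModulus (hK0 x) (hb ε hεle x) ?_ hθ
  exact fun θ hθ =>
    (hdiff x θ (hball (Metric.ball_subset_ball hεle hθ)).2).continuousAt.continuousWithinAt

theorem DominatedDeriv.integrable_fderiv_apply {Θ : Set (Fin d → ℝ)} (hΘ : IsOpen Θ)
    (h₀ : θ₀ ∈ Θ) {ν : Measure X} (hmeas : ∀ θ ∈ Θ, Measurable fun x => g x θ)
    (hdiff : ∀ x, DifferentiableAt ℝ (g x) θ₀)
    (hdom : DominatedDeriv ν g θ₀) (v : Fin d → ℝ) :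
    Integrable (fun x => fderiv ℝ (g x) θ₀ v) ν := by
  obtain ⟨V, hV, K, hKint, hK⟩ := hdom
  refine (hKint.mul_const ‖v‖).mono'
    (measurable_fderiv_apply hΘ h₀ hmeas hdiff v).aestronglyMeasurable
    (Eventually.of_forall fun x => ?_)
  exact (fderiv ℝ (g x) θ₀).le_of_opNorm_le (hK x θ₀ (mem_of_mem_nhds hV)) v

variable {Ω : Type w} [MeasurableSpace Ω] {μ : Measure Ω} [IsProbabilityMeasure μ]

/-- The first-order expansion of an empirical mean at a consistent estimator. -/
theorem empMean_sub_isLittleO {Θ : Set (Fin d → ℝ)} (hΘ : IsOpen Θ) (h₀ : θ₀ ∈ Θ) {ν : Measure X}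
    (hmeas : ∀ θ ∈ Θ, Measurable fun x => g x θ) (hC : ∀ x, ContDiffOn ℝ 1 (g x) Θ)
    (hdom : DominatedDeriv ν g θ₀) {y : ℕ → Ω → X} {n : ℕ → ℕ} (hy : ∀ i, Measurable (y i))
    (hlaw : ∀ i, μ.map (y i) = ν) (hind : iIndepFun y μ) (hn : Tendsto n atTop atTop)
    {θhat : ℕ → Ω → Fin d → ℝ} (hcons : TendstoInMeasure μ θhat atTop fun _ => θ₀) :
    (fun q : ℕ × Ω => empMean (n q.1) (fun i => y i q.2) (fun x => g x (θhat q.1 q.2))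
        - empMean (n q.1) (fun i => y i q.2) (fun x => g x θ₀)
        - ∑ k, (∫ x, fderiv ℝ (g x) θ₀ (Pi.single k 1) ∂ν) * (θhat q.1 q.2 - θ₀) k)
      =o[inProb μ] fun q : ℕ × Ω => θhat q.1 q.2 - θ₀ := by
  have hdiff : ∀ x, DifferentiableAt ℝ (g x) θ₀ := fun x =>
    ((hC x).differentiableOn one_ne_zero).differentiableAt (hΘ.mem_nhds h₀)
  have hθ : Tendsto (fun q : ℕ × Ω => θhat q.1 q.2) (inProb μ) (𝓝 θ₀) :=
    tendsto_inProb_iff.2 hcons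
  -- The sample gradient at θ₀ differs from its mean by o(1), by the law of large numbers.
  have hlin : (fun q : ℕ × Ω => ∑ k, (empMean (n q.1) (fun i => y i q.2)
        (fun x => fderiv ℝ (g x) θ₀ (Pi.single k 1)) -
        ∫ x, fderiv ℝ (g x) θ₀ (Pi.single k 1) ∂ν) * (θhat q.1 q.2 - θ₀) k)
      =o[inProb μ] fun q : ℕ × Ω => θhat q.1 q.2 - θ₀ := by
    refine IsLittleO.fun_sum fun k _ => ?_
    have h1 : (fun q : ℕ × Ω => empMean (n q.1) (fun i => y i q.2)
        (fun x => fderiv ℝ (g x) θ₀ (Pi.single k 1)) -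
        ∫ x, fderiv ℝ (g x) θ₀ (Pi.single k 1) ∂ν) =o[inProb μ] fun _ => (1 : ℝ) := by
      rw [isLittleO_one_iff, ← sub_self (∫ x, fderiv ℝ (g x) θ₀ (Pi.single k 1) ∂ν)]
      exact (tendsto_empMean hy hlaw hind hn (measurable_fderiv_apply hΘ h₀ hmeas hdiff _)
        (hdom.integrable_fderiv_apply hΘ h₀ hmeas hdiff _)).sub_const _
    have h2 : (fun q : ℕ × Ω => (θhat q.1 q.2 - θ₀) k) =O[inProb μ]
        fun q : ℕ × Ω => ‖θhat q.1 q.2 - θ₀‖ :=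
      IsBigO.of_bound 1 (Eventually.of_forall fun q => by
        rw [one_mul, norm_norm]; exact norm_le_pi_norm _ k)
    simpa using (h1.mul_isBigO h2)
  -- The modulus does not involve θ̂, so the law of large numbers applies to it although θ̂ depends
  -- on the sample.
  have hrem : (fun q : ℕ × Ω => empMean (n q.1) (fun i => y i q.2)
        (fun x => g x (θhat q.1 q.2) - g x θ₀ - fderiv ℝ (g x) θ₀ (θhat q.1 q.2 - θ₀)))
      =o[inProb μ] fun q : ℕ × Ω => θhat q.1 q.2 - θ₀ := by
    refine IsLittleO.of_bound fun δ hδ => ?_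
    obtain ⟨ε, hε, hm, hi, hlt, hb⟩ := exists_linModulus_lt hΘ h₀ hmeas hC hdom hδ
    filter_upwards [(tendsto_empMean hy hlaw hind hn hm hi).eventually_lt_const hlt,
      hθ (Metric.ball_mem_nhds θ₀ hε)] with q hq1 hq2
    calc _ ≤ empMean (n q.1) (fun i => y i q.2)
          (fun x => linModulus g θ₀ ε x * ‖θhat q.1 q.2 - θ₀‖) :=
          abs_empMean_le _ _ fun x => hb x _ hq2
      _ = empMean (n q.1) (fun i => y i q.2) (linModulus g θ₀ ε) * ‖θhat q.1 q.2 - θ₀‖ :=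
          empMean_mul_const _ _ _ _
      _ ≤ δ * ‖θhat q.1 q.2 - θ₀‖ := by gcongr
  refine (hrem.add hlin).congr_left fun q => ?_
  simp only [clm_apply_eq_sum (fderiv ℝ (g _) θ₀) (θhat q.1 q.2 - θ₀), sub_mul,
    Finset.sum_sub_distrib, empMean_sub, empMean_sum, empMean_mul_const]
  ring

end Expansion

/-! ### Central limit theorem for one sample -/

section CentralLimit

variable {X : Type u} [MeasurableSpace X] {Ω : Type w} [MeasurableSpace Ω] {μ : Measure Ω}
  [IsProbabilityMeasure μ] {ν : Measure X} {y : ℕ → Ω → X} {n : ℕ → ℕ}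

/-- The characteristic function of a rescaled centred empirical mean converges to that of a
centred normal law. -/
theorem tendsto_charFun_empMean (hy : ∀ i, Measurable (y i)) (hlaw : ∀ i, μ.map (y i) = ν)
    (hind : iIndepFun y μ) (hn : Tendsto n atTop atTop) {g : X → ℝ} (hg : Measurable g)
    (hLp : MemLp g 2 ν) {b : ℕ → ℝ} {a : ℝ} (hb : Tendsto b atTop (𝓝 a)) (t : ℝ) :
    Tendsto (fun k => charFun (μ.map fun ω => b k * √(n k) *
      (empMean (n k) (fun i => y i ω) g - ∫ x, g x ∂ν)) t) atTop
      (𝓝 (Complex.exp (-((a ^ 2 * Var[g; ν] : ℝ) * t ^ 2 / 2)))) := by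
  have hident : ∀ i, IdentDistrib (y i) (y 0) μ μ := fun i =>
    ⟨(hy i).aemeasurable, (hy 0).aemeasurable, by rw [hlaw, hlaw]⟩
  have hE : ∫ ω, g (y 0 ω) ∂μ = ∫ x, g x ∂ν := by
    rw [← hlaw 0, integral_map (hy 0).aemeasurable hg.aestronglyMeasurable]
  have hV : Var[fun ω => g (y 0 ω); μ] = Var[g; ν] := by
    rw [← hlaw 0, variance_map hg.aemeasurable (hy 0).aemeasurable]
    rfl
  have hLp' : MemLp (fun ω => g (y 0 ω)) 2 μ := by
    rw [← hlaw 0] at hLp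
    exact hLp.comp_of_map (hy 0).aemeasurable
  have hclt := tendstoInDistribution_inv_sqrt_mul_sum_sub (P := μ)
    (P' := gaussianReal 0 Var[fun ω => g (y 0 ω); μ].toNNReal) (Y := id)
    (X := fun i ω => g (y i ω)) ⟨by fun_prop, by simp⟩ hLp'
    (hind.comp (fun _ => g) fun _ => hg) (fun i => (hident i).comp hg)
  have hclt' : TendstoInDistribution (fun k ω => (√(n k))⁻¹ *
      (∑ i ∈ Finset.range (n k), g (y i ω) - n k * ∫ x, g x ∂ν)) atTop id (fun _ => μ)
      (gaussianReal 0 Var[g; ν].toNNReal) := by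
    rw [hV] at hclt
    simp only [hE] at hclt
    exact ⟨fun k => hclt.forall_aemeasurable (n k), hclt.aemeasurable_limit, hclt.tendsto.comp hn⟩
  -- Slutsky's theorem, with the deterministic factor b viewed as a random sequence with constant
  -- limit a.
  have hprod := hclt'.continuous_comp_prodMk_of_tendstoInMeasure_const
    (g := fun p : ℝ × ℝ => p.1 * p.2) (by fun_prop) (Y := fun k _ => b k) (c := a)
    (tendstoInMeasure_of_tendsto_ae (fun _ => aestronglyMeasurable_const)
      (Eventually.of_forall fun _ => hb)) (fun _ => aemeasurable_const)
  have hcf := ProbabilityMeasure.tendsto_iff_tendsto_charFun.1 hprod.tendsto t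
  simp only [ProbabilityMeasure.coe_mk, id_eq, gaussianReal_map_mul_const,
    charFun_gaussianReal] at hcf
  have hlimit : Complex.exp (-((a ^ 2 * Var[g; ν] : ℝ) * t ^ 2 / 2)) =
      Complex.exp (t * ((a * 0 : ℝ) : ℂ) * Complex.I -
        ((NNReal.mk (a ^ 2) (sq_nonneg _) * Var[g; ν].toNNReal : NNReal) : ℝ) * t ^ 2 / 2) := by
    congr 1
    have : ((NNReal.mk (a ^ 2) (sq_nonneg _) * Var[g; ν].toNNReal : NNReal) : ℝ)
        = a ^ 2 * Var[g; ν] := by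
      simp [variance_nonneg]
    rw [this]
    simp
  rw [hlimit]
  refine hcf.congr fun k => ?_
  congr 2
  ext ω
  rw [empMean]
  -- For an empty sample both sides are 0, because √0 = 0 and 0⁻¹ = 0.
  rcases Nat.eq_zero_or_pos (n k) with h0 | h0
  · simp [h0]
  · have h1 : (0 : ℝ) < n k := by exact_mod_cast h0
    have h2 : (√(n k : ℝ)) * √(n k) = n k := Real.mul_self_sqrt h1.le
    have h3 : √(n k : ℝ) ≠ 0 := (Real.sqrt_pos.2 h1).ne'
    field_simp
    rw [sq, h2]

end CentralLimit

/-! ### Central limit theorem for two independent samples -/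

section TwoSample

variable {X : Type u} [MeasurableSpace X] {d : ℕ} {P : TwoSampleLaw X d} {Ω : Type w}
  [MeasurableSpace Ω] {μ : Measure Ω} [IsProbabilityMeasure μ] {xn xd : ℕ → Ω → X}
  {ρ : ℝ} {mn md : ℕ → ℕ}

omit [IsProbabilityMeasure μ] in
theorem IsTwoSample.indep_n (h : IsTwoSample P μ xn xd) : iIndepFun xn μ :=
  h.indep.precomp (g := Sum.inl) Sum.inl_injective

omit [IsProbabilityMeasure μ] in
theorem IsTwoSample.indep_d (h : IsTwoSample P μ xn xd) : iIndepFun xd μ :=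
  h.indep.precomp (g := Sum.inr) Sum.inr_injective

omit [IsProbabilityMeasure μ] in
-- The two means are measurable functions of subfamilies of one independent family, indexed by
-- disjoint finite subsets of ℕ ⊕ ℕ.
theorem IsTwoSample.indepFun_empMean (h : IsTwoSample P μ xn xd) {φn φd : X → ℝ}
    (hφn : Measurable φn) (hφd : Measurable φd) (a b : ℕ) :
    IndepFun (fun ω => empMean b (fun i => xd i ω) φd) (fun ω => empMean a (fun i => xn i ω) φn)
      μ := by
  have hm : ∀ i, Measurable (Sum.elim xn xd i) := by
    rintro (i | i)
    exacts [h.measurable_n i, h.measurable_d i]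
  have hdisj : Disjoint ((Finset.range b).map ⟨Sum.inr, Sum.inr_injective⟩ : Finset (ℕ ⊕ ℕ))
      ((Finset.range a).map ⟨Sum.inl, Sum.inl_injective⟩) := by
    rw [Finset.disjoint_left]
    simp
  have hi := h.indep.indepFun_finset _ _ hdisj hm
  have hmeas : ∀ (s : Finset (ℕ ⊕ ℕ)) (c : ℝ) {φ : X → ℝ}, Measurable φ →
      Measurable fun z : s → X => c * ∑ i, φ (z i) := fun s c φ hφ =>
    measurable_const.mul (Finset.measurable_fun_sum _ fun i _ => hφ.comp (measurable_pi_apply i))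
  convert hi.comp (hmeas _ (b : ℝ)⁻¹ hφd) (hmeas _ (a : ℝ)⁻¹ hφn) using 1
  · ext ω
    simp only [empMean, Function.comp_apply]
    rw [Finset.sum_coe_sort _ (fun i => φd (Sum.elim xn xd i ω)), Finset.sum_map]
    rfl
  · ext ω
    simp only [empMean, Function.comp_apply]
    rw [Finset.sum_coe_sort _ (fun i => φn (Sum.elim xn xd i ω)), Finset.sum_map]
    rfl

/-- This weight is √m / √m_d, the factor that passes from the scaling of one sample to the common
scaling. -/
theorem IsSampling.tendsto_weight_d (h : IsSampling ρ mn md) (hρ : 0 < ρ) :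
    Tendsto (fun k => √((mn k : ℝ) / (mn k + md k))) atTop (𝓝 √(ρ / (ρ + 1))) := by
  refine Tendsto.sqrt ((h.ratio.div (h.ratio.add_const 1) (by positivity)).congr' ?_)
  filter_upwards [h.tendsto_d.eventually_gt_atTop 0] with k hk
  have : (0 : ℝ) < md k := by exact_mod_cast hk
  simp only [Pi.div_apply]
  field_simp

theorem IsSampling.tendsto_weight_n (h : IsSampling ρ mn md) (hρ : 0 < ρ) :
    Tendsto (fun k => √((md k : ℝ) / (mn k + md k))) atTop (𝓝 √(1 / (ρ + 1))) := by
  refine Tendsto.sqrt (((tendsto_const_nhds (x := (1 : ℝ))).div (h.ratio.add_const 1)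
    (by positivity)).congr' ?_)
  filter_upwards [h.tendsto_d.eventually_gt_atTop 0] with k hk
  have : (0 : ℝ) < md k := by exact_mod_cast hk
  simp only [Pi.div_apply]
  field_simp

/-- The central limit theorem for the sum of the empirical means of two independent samples. -/
theorem tendstoInDistribution_twoSample (h : IsTwoSample P μ xn xd) (hs : IsSampling ρ mn md)
    (hρ : 0 < ρ) {φn φd : X → ℝ} (hφn : Measurable φn) (hφd : Measurable φd)
    (hLn : MemLp φn 2 P.Pn) (hLd : MemLp φd 2 P.Pd) :
    TendstoInDistribution (fun k ω => √(effSize (mn k) (md k)) *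
        (empMean (md k) (fun i => xd i ω) φd + empMean (mn k) (fun i => xn i ω) φn
          - (∫ x, φd x ∂P.Pd + ∫ x, φn x ∂P.Pn)))
      atTop (id : ℝ → ℝ) (fun _ => μ)
      (gaussianReal 0 (ρ / (ρ + 1) * Var[φd; P.Pd] + 1 / (ρ + 1) * Var[φn; P.Pn]).toNNReal) := by
  have hmd := fun k => measurable_empMean (md k) h.measurable_d hφd
  have hmn := fun k => measurable_empMean (mn k) h.measurable_n hφn
  refine ⟨fun k => Measurable.aemeasurable ?_, aemeasurable_id, ?_⟩
  · exact measurable_const.mul (((hmd k).add (hmn k)).sub_const _)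
  refine ProbabilityMeasure.tendsto_iff_tendsto_charFun.2 fun t => ?_
  have hd := tendsto_charFun_empMean h.measurable_d h.law_d h.indep_d hs.tendsto_d hφd hLd
    (hs.tendsto_weight_d hρ) t
  have hn := tendsto_charFun_empMean h.measurable_n h.law_n h.indep_n hs.tendsto_n hφn hLn
    (hs.tendsto_weight_n hρ) t
  have hlim := hd.mul hn
  rw [← Complex.exp_add, Real.sq_sqrt (by positivity), Real.sq_sqrt (by positivity)] at hlim
  simp only [ProbabilityMeasure.coe_mk, Measure.map_id, charFun_gaussianReal]
  have hv : 0 ≤ ρ / (ρ + 1) * Var[φd; P.Pd] + 1 / (ρ + 1) * Var[φn; P.Pn] := by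
    have := variance_nonneg φd P.Pd
    have := variance_nonneg φn P.Pn
    positivity
  rw [Real.coe_toNNReal _ hv]
  refine (hlim.congr fun k => ?_).trans_eq ?_
  -- Independence turns the product of the characteristic functions into that of the sum.
  · rw [← Pi.mul_apply, ← IndepFun.charFun_map_fun_add_eq_mul]
    · congr 2
      ext ω
      have e1 : √(effSize (mn k) (md k)) = √((mn k : ℝ) / (mn k + md k)) * √(md k) := by
        rw [← Real.sqrt_mul (by positivity), effSize]
        congr 1; ring
      have e2 : √(effSize (mn k) (md k)) = √((md k : ℝ) / (mn k + md k)) * √(mn k) := by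
        rw [← Real.sqrt_mul (by positivity), effSize]
        congr 1; ring
      rw [← e1, ← e2]
      ring
    · exact (measurable_const.mul ((hmd k).sub_const _)).aemeasurable
    · exact (measurable_const.mul ((hmn k).sub_const _)).aemeasurable
    · exact (h.indepFun_empMean hφn hφd (mn k) (md k)).comp
        (measurable_const.mul (measurable_id.sub_const _))
        (measurable_const.mul (measurable_id.sub_const _))
  · congr 2
    push_cast
    ring

end TwoSample

/-! ### Change of measure and the expected derivatives `U` and `c` -/

section Model

variable {X : Type u} [MeasurableSpace X] {d : ℕ} {Θ : Set (Fin d → ℝ)}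
  {r : X → (Fin d → ℝ) → ℝ} {P : TwoSampleLaw X d} {S : Scheme X d} {f : ℝ → ℝ}

theorem IsRatioModel.differentiableAt (hr : IsRatioModel Θ r) (x : X) {θ : Fin d → ℝ}
    (hθ : θ ∈ Θ) : DifferentiableAt ℝ (r x) θ :=
  ((hr.contDiffOn x).differentiableOn one_ne_zero).differentiableAt (hr.isOpen.mem_nhds hθ)

/-- F is controlled only on (0,∞), so measurability is obtained on the subtype, where `r` takes its
values. -/
theorem IsRatioModel.measurable_comp (hr : IsRatioModel Θ r) {F : ℝ → ℝ}
    (hF : ContinuousOn F (Ioi 0)) {θ : Fin d → ℝ} (hθ : θ ∈ Θ) : Measurable fun x => F (r x θ) :=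
  hF.domRestrict.measurable.comp ((hr.measurable θ hθ).subtype_mk (h := fun x => hr.pos x θ hθ))

theorem IsRatioModel.contDiffOn_comp (hr : IsRatioModel Θ r) {F : ℝ → ℝ}
    (hF : ContDiffOn ℝ 1 F (Ioi 0)) (x : X) : ContDiffOn ℝ 1 (fun θ => F (r x θ)) Θ :=
  hF.comp (hr.contDiffOn x) fun θ hθ => hr.pos x θ hθ

theorem IsRatioModel.fderiv_comp (hr : IsRatioModel Θ r) {F : ℝ → ℝ}
    (hF : ContDiffOn ℝ 1 F (Ioi 0)) (x : X) {θ : Fin d → ℝ} (hθ : θ ∈ Θ) (v : Fin d → ℝ) :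
    fderiv ℝ (fun t => F (r x t)) θ v = deriv F (r x θ) * fderiv ℝ (r x) θ v := by
  have h1 : DifferentiableAt ℝ F (r x θ) := (hF.differentiableOn one_ne_zero).differentiableAt
    (Ioi_mem_nhds (hr.pos x θ hθ))
  have := h1.hasDerivAt.comp_hasFDerivAt θ (hr.differentiableAt x hθ).hasFDerivAt
  have h2 := this.fderiv
  simp only [Function.comp_def] at h2
  rw [h2]
  rfl

theorem IsRatioModel.gradLog_apply (hr : IsRatioModel Θ r) (x : X) {θ : Fin d → ℝ}
    (hθ : θ ∈ Θ) (k : Fin d) :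
    gradLog r θ x k = (r x θ)⁻¹ * fderiv ℝ (r x) θ (Pi.single k 1) := by
  rw [gradLog, fderiv.log (hr.differentiableAt x hθ) (hr.pos x θ hθ).ne']
  rfl

theorem IsRatioModel.mul_gradLog (hr : IsRatioModel Θ r) (x : X) {θ : Fin d → ℝ}
    (hθ : θ ∈ Θ) (k : Fin d) :
    r x θ * gradLog r θ x k = fderiv ℝ (r x) θ (Pi.single k 1) := by
  rw [hr.gradLog_apply x hθ, mul_inv_cancel_left₀ (hr.pos x θ hθ).ne']

theorem TwoSampleLaw.InModel.integrable_iff (hP : P.InModel Θ r) (hr : IsRatioModel Θ r)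
    {g : X → ℝ} : Integrable g P.Pn ↔ Integrable (fun x => r x P.θ * g x) P.Pd := by
  rw [hP.ratio, integrable_withDensity_iff_integrable_smul'
    (hr.measurable _ hP.mem).ennreal_ofReal (by simp)]
  simp only [ENNReal.toReal_ofReal (hr.pos _ _ hP.mem).le, smul_eq_mul]

theorem TwoSampleLaw.InModel.integral_eq (hP : P.InModel Θ r) (hr : IsRatioModel Θ r)
    (g : X → ℝ) : ∫ x, g x ∂P.Pn = ∫ x, r x P.θ * g x ∂P.Pd := by
  rw [hP.ratio, integral_withDensity_eq_integral_toReal_smul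
    (hr.measurable _ hP.mem).ennreal_ofReal (by simp)]
  simp only [ENNReal.toReal_ofReal (hr.pos _ _ hP.mem).le, smul_eq_mul]

theorem TwoSampleLaw.InModel.fDivergence_eq (hP : P.InModel Θ r) (hr : IsRatioModel Θ r) :
    fDivergence f P.Pd P.Pn = ∫ x, f (r x P.θ) ∂P.Pd := by
  have := hP.prob_d
  refine integral_congr_ae ?_
  rw [hP.ratio]
  filter_upwards [Measure.rnDeriv_withDensity P.Pd (hr.measurable _ hP.mem).ennreal_ofReal]
    with x hx
  rw [hx, ENNReal.toReal_ofReal (hr.pos _ _ hP.mem).le]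

theorem contDiffOn_apply {G : (Fin d → ℝ) → (Fin d → ℝ)} (hG : ContDiffOn ℝ 1 G Θ) (i : Fin d) :
    ContDiffOn ℝ 1 (fun θ => G θ i) Θ := contDiffOn_pi.1 hG i

theorem Scheme.Regular.measurable_η_apply (hS : S.Regular Θ r P) {θ : Fin d → ℝ} (hθ : θ ∈ Θ)
    (i : Fin d) : Measurable fun x => S.η x θ i :=
  measurable_pi_iff.1 (hS.measurable_η θ hθ) i

theorem Scheme.Regular.measurable_fd (hS : S.Regular Θ r P) (hr : IsRatioModel Θ r)
    {θ : Fin d → ℝ} (hθ : θ ∈ Θ) : Measurable fun x => S.fd (r x θ) :=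
  hr.measurable_comp hS.contDiffOn_fd.continuousOn hθ

theorem Scheme.Regular.measurable_fn (hS : S.Regular Θ r P) (hr : IsRatioModel Θ r)
    {θ : Fin d → ℝ} (hθ : θ ∈ Θ) : Measurable fun x => S.fn (r x θ) :=
  hr.measurable_comp hS.contDiffOn_fn.continuousOn hθ

theorem Scheme.Regular.differentiableAt_η (hS : S.Regular Θ r P) (hr : IsRatioModel Θ r)
    (x : X) {θ : Fin d → ℝ} (hθ : θ ∈ Θ) (i : Fin d) :
    DifferentiableAt ℝ (fun t => S.η x t i) θ :=
  ((contDiffOn_apply (hS.contDiffOn_η x) i).differentiableOn one_ne_zero).differentiableAt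
    (hr.isOpen.mem_nhds hθ)

theorem Scheme.Regular.contDiffOn_mul_η (hS : S.Regular Θ r P) (hr : IsRatioModel Θ r)
    (x : X) (i : Fin d) : ContDiffOn ℝ 1 (fun θ => r x θ * S.η x θ i) Θ :=
  (hr.contDiffOn x).mul (contDiffOn_apply (hS.contDiffOn_η x) i)

theorem Scheme.Regular.integrable_fderiv_mul_η (hS : S.Regular Θ r P) (hr : IsRatioModel Θ r)
    (hP : P.InModel Θ r) (i : Fin d) (v : Fin d → ℝ) :
    Integrable (fun x => fderiv ℝ (fun θ => r x θ * S.η x θ i) P.θ v) P.Pd :=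
  (hS.dominated_η_d i).integrable_fderiv_apply (g := fun x θ => r x θ * S.η x θ i) hr.isOpen
    hP.mem (fun θ hθ => (hr.measurable θ hθ).mul (hS.measurable_η_apply hθ i))
    (fun x => (hr.differentiableAt x hP.mem).mul (hS.differentiableAt_η hr x hP.mem i)) v

theorem Scheme.Regular.integrable_fderiv_η (hS : S.Regular Θ r P) (hr : IsRatioModel Θ r)
    (hP : P.InModel Θ r) (i : Fin d) (v : Fin d → ℝ) :
    Integrable (fun x => fderiv ℝ (fun θ => S.η x θ i) P.θ v) P.Pn :=
  (hS.dominated_η_n i).integrable_fderiv_apply (g := fun x θ => S.η x θ i) hr.isOpen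
    hP.mem (fun _ hθ => hS.measurable_η_apply hθ i)
    (fun x => hS.differentiableAt_η hr x hP.mem i) v

/-- The product rule with r ∇log r = ∇r. It writes the integrand of `U`, moved to p_d, as a
difference of dominated derivatives, hence integrable with no moment condition on ∇log r. -/
theorem Scheme.Regular.fderiv_mul_η (hS : S.Regular Θ r P) (hr : IsRatioModel Θ r)
    (hP : P.InModel Θ r) (i j : Fin d) (x : X) :
    r x P.θ * (S.η x P.θ i * gradLog r P.θ x j) =
      fderiv ℝ (fun θ => r x θ * S.η x θ i) P.θ (Pi.single j 1)
        - r x P.θ * fderiv ℝ (fun θ => S.η x θ i) P.θ (Pi.single j 1) := by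
  have h := fderiv_fun_mul (hr.differentiableAt x hP.mem) (hS.differentiableAt_η hr x hP.mem i)
  rw [h, mul_left_comm, hr.mul_gradLog x hP.mem]
  simp

theorem Scheme.Regular.integrable_η_mul_gradLog (hS : S.Regular Θ r P) (hr : IsRatioModel Θ r)
    (hP : P.InModel Θ r) (i j : Fin d) :
    Integrable (fun x => S.η x P.θ i * gradLog r P.θ x j) P.Pn := by
  rw [hP.integrable_iff hr]
  simp only [hS.fderiv_mul_η hr hP]
  exact (hS.integrable_fderiv_mul_η hr hP i _).sub
    ((hP.integrable_iff hr).1 (hS.integrable_fderiv_η hr hP i _))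

/-- `U_η` is the expected derivative of the estimating function. -/
theorem Scheme.Regular.U_eq (hS : S.Regular Θ r P) (hr : IsRatioModel Θ r)
    (hP : P.InModel Θ r) (i j : Fin d) :
    S.U r P i j = ∫ x, fderiv ℝ (fun θ => r x θ * S.η x θ i) P.θ (Pi.single j 1) ∂P.Pd
      - ∫ x, fderiv ℝ (fun θ => S.η x θ i) P.θ (Pi.single j 1) ∂P.Pn := by
  rw [Scheme.U, of_apply, hP.integral_eq hr,
    hP.integral_eq hr (fun x => fderiv ℝ (fun θ => S.η x θ i) P.θ (Pi.single j 1)),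
    ← integral_sub (hS.integrable_fderiv_mul_η hr hP i _)
      ((hP.integrable_iff hr).1 (hS.integrable_fderiv_η hr hP i _))]
  simp only [hS.fderiv_mul_η hr hP]

theorem Scheme.Regular.integrable_fderiv_fd (hS : S.Regular Θ r P) (hr : IsRatioModel Θ r)
    (hP : P.InModel Θ r) (v : Fin d → ℝ) :
    Integrable (fun x => fderiv ℝ (fun θ => S.fd (r x θ)) P.θ v) P.Pd :=
  hS.dominated_fd.integrable_fderiv_apply hr.isOpen hP.mem
    (fun _ hθ => hS.measurable_fd hr hθ)
    (fun x => ((hr.contDiffOn_comp hS.contDiffOn_fd x).differentiableOn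
      one_ne_zero).differentiableAt (hr.isOpen.mem_nhds hP.mem)) v

theorem Scheme.Regular.integrable_fderiv_fn (hS : S.Regular Θ r P) (hr : IsRatioModel Θ r)
    (hP : P.InModel Θ r) (v : Fin d → ℝ) :
    Integrable (fun x => fderiv ℝ (fun θ => S.fn (r x θ)) P.θ v) P.Pn :=
  hS.dominated_fn.integrable_fderiv_apply hr.isOpen hP.mem
    (fun _ hθ => hS.measurable_fn hr hθ)
    (fun x => ((hr.contDiffOn_comp hS.contDiffOn_fn x).differentiableOn
      one_ne_zero).differentiableAt (hr.isOpen.mem_nhds hP.mem)) v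

theorem Scheme.Regular.deriv_decomposition (hS : S.Regular Θ r P) (hdec : S.Decomposes f) {t : ℝ}
    (ht : 0 < t) : deriv f t = deriv S.fd t + (S.fn t + t * deriv S.fn t) := by
  have hd : HasDerivAt S.fd (deriv S.fd t) t :=
    ((hS.contDiffOn_fd.differentiableOn one_ne_zero).differentiableAt (Ioi_mem_nhds ht)).hasDerivAt
  have hn : HasDerivAt S.fn (deriv S.fn t) t :=
    ((hS.contDiffOn_fn.differentiableOn one_ne_zero).differentiableAt (Ioi_mem_nhds ht)).hasDerivAt
  have h := hd.add ((hasDerivAt_id t).mul hn)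
  have heq : f =ᶠ[𝓝 t] S.fd + id * S.fn := by
    filter_upwards [Ioi_mem_nhds ht] with s hs
    exact hdec s hs
  rw [heq.deriv_eq, h.deriv]
  simp

/-- From f' - f_n = f_d' + t f_n'. It plays for `c` the role that `fderiv_mul_η` plays for `U`. -/
theorem Scheme.Regular.fderiv_fd_add (hS : S.Regular Θ r P) (hr : IsRatioModel Θ r)
    (hP : P.InModel Θ r) (hdec : S.Decomposes f) (j : Fin d) (x : X) :
    r x P.θ * ((deriv f (r x P.θ) - S.fn (r x P.θ)) * gradLog r P.θ x j) =
      fderiv ℝ (fun θ => S.fd (r x θ)) P.θ (Pi.single j 1)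
        + r x P.θ * fderiv ℝ (fun θ => S.fn (r x θ)) P.θ (Pi.single j 1) := by
  rw [hr.fderiv_comp hS.contDiffOn_fd x hP.mem, hr.fderiv_comp hS.contDiffOn_fn x hP.mem,
    mul_left_comm, hr.mul_gradLog x hP.mem, hS.deriv_decomposition hdec (hr.pos x _ hP.mem)]
  ring

theorem Scheme.Regular.integrable_c (hS : S.Regular Θ r P) (hr : IsRatioModel Θ r)
    (hP : P.InModel Θ r) (hdec : S.Decomposes f) (j : Fin d) :
    Integrable (fun x => (deriv f (r x P.θ) - S.fn (r x P.θ)) * gradLog r P.θ x j) P.Pn := by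
  rw [hP.integrable_iff hr]
  simp only [hS.fderiv_fd_add hr hP hdec]
  exact (hS.integrable_fderiv_fd hr hP _).add
    ((hP.integrable_iff hr).1 (hS.integrable_fderiv_fn hr hP _))

/-- `c` is the expected derivative of the plug-in estimate of the divergence. -/
theorem Scheme.Regular.c_eq (hS : S.Regular Θ r P) (hr : IsRatioModel Θ r)
    (hP : P.InModel Θ r) (hdec : S.Decomposes f) (j : Fin d) :
    S.c r f P j = ∫ x, fderiv ℝ (fun θ => S.fd (r x θ)) P.θ (Pi.single j 1) ∂P.Pd
      + ∫ x, fderiv ℝ (fun θ => S.fn (r x θ)) P.θ (Pi.single j 1) ∂P.Pn := by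
  rw [Scheme.c, hP.integral_eq hr,
    hP.integral_eq hr (fun x => fderiv ℝ (fun θ => S.fn (r x θ)) P.θ (Pi.single j 1)),
    ← integral_add (hS.integrable_fderiv_fd hr hP _)
      ((hP.integrable_iff hr).1 (hS.integrable_fderiv_fn hr hP _))]
  simp only [hS.fderiv_fd_add hr hP hdec]

/-- The coefficients `U_η⁻ᵀ c` of the influence function. -/
def Scheme.weight (S : Scheme X d) (r : X → (Fin d → ℝ) → ℝ) (f : ℝ → ℝ) (P : TwoSampleLaw X d) :
    Fin d → ℝ := S.c r f P ᵥ* (S.U r P)⁻¹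

theorem Scheme.cUη_eq_sum (S : Scheme X d) (x : X) :
    S.cUη r f P x = ∑ i, S.weight r f P i * S.η x P.θ i := by
  rw [Scheme.cUη, dotProduct_mulVec]
  rfl

theorem Scheme.Regular.weight_vecMul_U (hS : S.Regular Θ r P) :
    S.weight r f P ᵥ* S.U r P = S.c r f P := by
  rw [Scheme.weight, vecMul_vecMul, nonsing_inv_mul _ hS.nondegenerate, vecMul_one]

theorem Scheme.Regular.measurable_cUη (hS : S.Regular Θ r P) (hP : P.InModel Θ r) :
    Measurable (S.cUη r f P) := by
  simp only [funext S.cUη_eq_sum]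
  exact Finset.measurable_fun_sum _ fun i _ =>
    measurable_const.mul (hS.measurable_η_apply hP.mem i)

theorem Scheme.Regular.memLp_cUη (hS : S.Regular Θ r P) : MemLp (S.cUη r f P) 2 P.Pn := by
  rw [funext S.cUη_eq_sum]
  exact memLp_finsetSum _ fun i _ => (hS.memLp_η_n i).const_mul _

theorem Scheme.Regular.memLp_mul_cUη (hS : S.Regular Θ r P) :
    MemLp (fun x => r x P.θ * S.cUη r f P x) 2 P.Pd := by
  have : (fun x => r x P.θ * S.cUη r f P x) =
      fun x => ∑ i, S.weight r f P i * (r x P.θ * S.η x P.θ i) := by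
    ext x
    rw [S.cUη_eq_sum, Finset.mul_sum]
    exact Finset.sum_congr rfl fun i _ => by ring
  rw [this]
  exact memLp_finsetSum _ fun i _ => (hS.memLp_η_d i).const_mul _

end Model

/-! ### Influence functions and asymptotic normality -/

section Normality

variable {X : Type u} [MeasurableSpace X] {d : ℕ} {Θ : Set (Fin d → ℝ)}
  {r : X → (Fin d → ℝ) → ℝ} {P : TwoSampleLaw X d} {S : Scheme X d} {f : ℝ → ℝ}
  {Ω : Type w} [MeasurableSpace Ω] {μ : Measure Ω} [IsProbabilityMeasure μ]
  {xn xd : ℕ → Ω → X} {ρ : ℝ} {mn md : ℕ → ℕ} {θhat : ℕ → Ω → Fin d → ℝ}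

omit [MeasurableSpace X] in
theorem Scheme.Q_apply (S : Scheme X d) (a b : ℕ) (yn yd : ℕ → X) (θ : Fin d → ℝ) (i : Fin d) :
    S.Q r a b yn yd θ i = empMean b yd (fun x => r x θ * S.η x θ i)
      - empMean a yn (fun x => S.η x θ i) := by
  simp [Scheme.Q, empMean]

omit [MeasurableSpace X] in
theorem Scheme.estimate_eq (S : Scheme X d) (a b : ℕ) (yn yd : ℕ → X) (θ : Fin d → ℝ) :
    S.estimate r a b yn yd θ = empMean b yd (fun x => S.fd (r x θ))
      + empMean a yn (fun x => S.fn (r x θ)) := rfl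

/-- The first-order expansion of the estimating function. -/
theorem Scheme.Regular.Q_sub_isLittleO (hS : S.Regular Θ r P) (hr : IsRatioModel Θ r)
    (hP : P.InModel Θ r) (h : IsTwoSample P μ xn xd) (hs : IsSampling ρ mn md)
    (hθ : TendstoInMeasure μ θhat atTop fun _ => P.θ) :
    (fun q : ℕ × Ω =>
        S.Q r (mn q.1) (md q.1) (fun i => xn i q.2) (fun i => xd i q.2) (θhat q.1 q.2)
        - S.Q r (mn q.1) (md q.1) (fun i => xn i q.2) (fun i => xd i q.2) P.θ
        - S.U r P *ᵥ (θhat q.1 q.2 - P.θ))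
      =o[inProb μ] fun q : ℕ × Ω => θhat q.1 q.2 - P.θ := by
  refine isLittleO_pi.2 fun i => ?_
  have h1 := empMean_sub_isLittleO (g := fun x θ => r x θ * S.η x θ i) hr.isOpen hP.mem
    (fun θ hθ => (hr.measurable θ hθ).mul (hS.measurable_η_apply hθ i))
    (fun x => hS.contDiffOn_mul_η hr x i) (hS.dominated_η_d i) h.measurable_d h.law_d h.indep_d
    hs.tendsto_d hθ
  have h2 := empMean_sub_isLittleO (g := fun x θ => S.η x θ i) hr.isOpen hP.mem
    (fun θ hθ => hS.measurable_η_apply hθ i)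
    (fun x => contDiffOn_apply (hS.contDiffOn_η x) i) (hS.dominated_η_n i) h.measurable_n h.law_n
    h.indep_n hs.tendsto_n hθ
  refine (h1.sub h2).congr_left fun q => ?_
  simp only [Pi.sub_apply, S.Q_apply, mulVec, dotProduct, hS.U_eq hr hP, sub_mul,
    Finset.sum_sub_distrib]
  ring

/-- The first-order expansion of the plug-in estimate. -/
theorem Scheme.Regular.estimate_sub_isLittleO (hS : S.Regular Θ r P) (hr : IsRatioModel Θ r)
    (hP : P.InModel Θ r) (hdec : S.Decomposes f) (h : IsTwoSample P μ xn xd)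
    (hs : IsSampling ρ mn md) (hθ : TendstoInMeasure μ θhat atTop fun _ => P.θ) :
    (fun q : ℕ × Ω =>
        S.estimate r (mn q.1) (md q.1) (fun i => xn i q.2) (fun i => xd i q.2) (θhat q.1 q.2)
        - S.estimate r (mn q.1) (md q.1) (fun i => xn i q.2) (fun i => xd i q.2) P.θ
        - S.c r f P ⬝ᵥ (θhat q.1 q.2 - P.θ))
      =o[inProb μ] fun q : ℕ × Ω => θhat q.1 q.2 - P.θ := by
  have h1 := empMean_sub_isLittleO (g := fun x θ => S.fd (r x θ)) hr.isOpen hP.mem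
    (fun _ hθ => hS.measurable_fd hr hθ)
    (fun x => hr.contDiffOn_comp hS.contDiffOn_fd x) hS.dominated_fd h.measurable_d h.law_d
    h.indep_d hs.tendsto_d hθ
  have h2 := empMean_sub_isLittleO (g := fun x θ => S.fn (r x θ)) hr.isOpen hP.mem
    (fun _ hθ => hS.measurable_fn hr hθ)
    (fun x => hr.contDiffOn_comp hS.contDiffOn_fn x) hS.dominated_fn h.measurable_n h.law_n
    h.indep_n hs.tendsto_n hθ
  refine (h1.add h2).congr_left fun q => ?_
  simp only [Pi.sub_apply, S.estimate_eq, dotProduct, hS.c_eq hr hP hdec, add_mul,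
    Finset.sum_add_distrib]
  ring

/-- A solution of the estimating equation deviates from the truth by at most the order of the
estimating function at the truth. -/
theorem Scheme.Regular.sub_isBigO_Q (hS : S.Regular Θ r P) (hr : IsRatioModel Θ r)
    (hP : P.InModel Θ r) (h : IsTwoSample P μ xn xd) (hs : IsSampling ρ mn md)
    (hθ : S.IsMomentMatching Θ r P μ xn xd mn md θhat) :
    (fun q : ℕ × Ω => S.Q r (mn q.1) (md q.1) (fun i => xn i q.2) (fun i => xd i q.2) P.θ
        + S.U r P *ᵥ (θhat q.1 q.2 - P.θ)) =o[inProb μ] (fun q : ℕ × Ω => θhat q.1 q.2 - P.θ) ∧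
    (fun q : ℕ × Ω => θhat q.1 q.2 - P.θ) =O[inProb μ] fun q : ℕ × Ω =>
      S.Q r (mn q.1) (md q.1) (fun i => xn i q.2) (fun i => xd i q.2) P.θ := by
  have hroot : ∀ᶠ q in inProb μ, S.Q r (mn q.1) (md q.1) (fun i => xn i q.2)
      (fun i => xd i q.2) (θhat q.1 q.2) = 0 := eventually_inProb.2 hθ.root
  have h1 : (fun q : ℕ × Ω =>
      S.Q r (mn q.1) (md q.1) (fun i => xn i q.2) (fun i => xd i q.2) P.θ
        + S.U r P *ᵥ (θhat q.1 q.2 - P.θ)) =o[inProb μ] fun q : ℕ × Ω => θhat q.1 q.2 - P.θ := by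
    refine (hS.Q_sub_isLittleO hr hP h hs hθ.consistent).neg_left.congr' ?_ EventuallyEq.rfl
    filter_upwards [hroot] with q hq
    rw [hq]
    abel
  refine ⟨h1, ?_⟩
  let L : (Fin d → ℝ) →L[ℝ] (Fin d → ℝ) := LinearMap.toContinuousLinearMap (S.U r P)⁻¹.mulVecLin
  have hL : ∀ v, L v = (S.U r P)⁻¹ *ᵥ v := fun _ => rfl
  have h2 := (L.isBigO_comp (fun q : ℕ × Ω =>
      S.Q r (mn q.1) (md q.1) (fun i => xn i q.2) (fun i => xd i q.2) P.θ
        + S.U r P *ᵥ (θhat q.1 q.2 - P.θ)) (inProb μ)).trans_isLittleO h1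
  -- With e = θ̂ - θ, U⁻¹Q + e is o(e), so e is absorbed and is O(U⁻¹Q). Consistency alone thus
  -- yields the rate.
  have h3 := h2.neg_left.right_isBigO_add
  have h4 : (fun q : ℕ × Ω => θhat q.1 q.2 - P.θ) =O[inProb μ] fun q : ℕ × Ω =>
      L (S.Q r (mn q.1) (md q.1) (fun i => xn i q.2) (fun i => xd i q.2) P.θ) := by
    refine (h3.congr_right fun q => ?_).neg_right.congr_right fun q => neg_neg _
    simp only [hL, mulVec_add, mulVec_mulVec, nonsing_inv_mul _ hS.nondegenerate, one_mulVec]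
    abel
  exact h4.trans (L.isBigO_comp _ _)

/-- The numerator part of the influence function. -/
def Scheme.influenceN (S : Scheme X d) (r : X → (Fin d → ℝ) → ℝ) (f : ℝ → ℝ)
    (P : TwoSampleLaw X d) (x : X) : ℝ := S.fn (r x P.θ) + S.cUη r f P x

/-- The denominator part of the influence function. -/
def Scheme.influenceD (S : Scheme X d) (r : X → (Fin d → ℝ) → ℝ) (f : ℝ → ℝ)
    (P : TwoSampleLaw X d) (x : X) : ℝ := S.fd (r x P.θ) - r x P.θ * S.cUη r f P x

/-- An exact identity: the terms are regrouped by sample. -/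
theorem Scheme.estimate_sub_weight_Q (S : Scheme X d) (a b : ℕ) (yn yd : ℕ → X) :
    S.estimate r a b yn yd P.θ - S.weight r f P ⬝ᵥ S.Q r a b yn yd P.θ =
      empMean b yd (S.influenceD r f P) + empMean a yn (S.influenceN r f P) := by
  have h1 : S.influenceD r f P = fun x => S.fd (r x P.θ)
      - ∑ i, S.weight r f P i * (r x P.θ * S.η x P.θ i) := by
    ext x
    rw [Scheme.influenceD, S.cUη_eq_sum, Finset.mul_sum]
    congr 1
    exact Finset.sum_congr rfl fun i _ => by ring
  have h2 : S.influenceN r f P = fun x => S.fn (r x P.θ)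
      + ∑ i, S.weight r f P i * S.η x P.θ i := by
    ext x
    rw [Scheme.influenceN, S.cUη_eq_sum]
  rw [h1, h2, S.estimate_eq]
  simp only [empMean_sub, empMean_add, empMean_sum, empMean_const_mul, dotProduct, S.Q_apply,
    mul_sub, Finset.sum_sub_distrib]
  ring

/-- The linearization of the estimator. -/
theorem Scheme.Regular.estimate_linearization (hS : S.Regular Θ r P) (hr : IsRatioModel Θ r)
    (hP : P.InModel Θ r) (hdec : S.Decomposes f) (h : IsTwoSample P μ xn xd)
    (hs : IsSampling ρ mn md) (hθ : S.IsMomentMatching Θ r P μ xn xd mn md θhat) :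
    (fun q : ℕ × Ω =>
        S.estimate r (mn q.1) (md q.1) (fun i => xn i q.2) (fun i => xd i q.2) (θhat q.1 q.2)
        - (empMean (md q.1) (fun i => xd i q.2) (S.influenceD r f P)
          + empMean (mn q.1) (fun i => xn i q.2) (S.influenceN r f P)))
      =o[inProb μ] fun q : ℕ × Ω =>
        S.Q r (mn q.1) (md q.1) (fun i => xn i q.2) (fun i => xd i q.2) P.θ := by
  obtain ⟨h1, h2⟩ := hS.sub_isBigO_Q hr hP h hs hθ
  have h3 := hS.estimate_sub_isLittleO hr hP hdec h hs hθ.consistent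
  -- Since the weight times `U` is `c`, adding this to `h3` cancels the terms linear in θ̂ - θ.
  have h4 : (fun q : ℕ × Ω => S.weight r f P ⬝ᵥ
      (S.Q r (mn q.1) (md q.1) (fun i => xn i q.2) (fun i => xd i q.2) P.θ
        + S.U r P *ᵥ (θhat q.1 q.2 - P.θ))) =o[inProb μ] fun q : ℕ × Ω => θhat q.1 q.2 - P.θ :=
    IsLittleO.fun_sum fun i _ => (isLittleO_pi.1 h1 i).const_mul_left _
  refine ((h3.add h4).congr_left fun q => ?_).trans_isBigO h2
  rw [← S.estimate_sub_weight_Q, dotProduct_add, dotProduct_mulVec, hS.weight_vecMul_U]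
  ring

/-- `Q` is centred at the truth because E_d[rη] = E_n[η], so the central limit theorem makes each
coordinate tight. -/
theorem Scheme.Regular.boundedInProb_Q (hS : S.Regular Θ r P) (hr : IsRatioModel Θ r)
    (hP : P.InModel Θ r) (hρ : 0 < ρ) (h : IsTwoSample P μ xn xd) (hs : IsSampling ρ mn md) :
    BoundedInProb μ fun k ω => √(effSize (mn k) (md k)) •
      S.Q r (mn k) (md k) (fun i => xn i ω) (fun i => xd i ω) P.θ := by
  refine BoundedInProb.pi fun i => ?_
  have hclt := tendstoInDistribution_twoSample h hs hρ
    (φn := fun x => -1 * S.η x P.θ i) (φd := fun x => r x P.θ * S.η x P.θ i)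
    (measurable_const.mul (hS.measurable_η_apply hP.mem i))
    ((hr.measurable _ hP.mem).mul (hS.measurable_η_apply hP.mem i))
    ((hS.memLp_η_n i).const_mul _) (hS.memLp_η_d i)
  convert BoundedInProb.of_tendstoInDistribution hclt using 1
  ext k ω
  rw [Pi.smul_apply, smul_eq_mul, S.Q_apply, integral_const_mul, hP.integral_eq hr,
    empMean_const_mul]
  ring

/-- A Carathéodory function, measurable in x and continuous in θ, is jointly measurable. -/
theorem measurable_comp_estimator {g : X → (Fin d → ℝ) → ℝ}
    (hmeas : ∀ θ ∈ Θ, Measurable fun x => g x θ) (hcont : ∀ x, ContinuousOn (g x) Θ)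
    {y : Ω → X} (hy : Measurable y) {t : Ω → Fin d → ℝ} (ht : Measurable t)
    (htΘ : ∀ ω, t ω ∈ Θ) : Measurable fun ω => g (y ω) (t ω) := by
  have : Measurable (Function.uncurry fun (θ : Θ) x => g x θ) :=
    measurable_uncurry_of_continuous_of_measurable (fun x => (hcont x).domRestrict)
      fun θ => hmeas θ θ.2
  exact this.comp ((ht.subtype_mk (h := htΘ)).prodMk hy)

omit [IsProbabilityMeasure μ] in
theorem Scheme.Regular.measurable_estimate (hS : S.Regular Θ r P) (hr : IsRatioModel Θ r)
    (h : IsTwoSample P μ xn xd) {t : Ω → Fin d → ℝ} (ht : Measurable t) (htΘ : ∀ ω, t ω ∈ Θ)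
    (a b : ℕ) :
    Measurable fun ω => S.estimate r a b (fun i => xn i ω) (fun i => xd i ω) (t ω) := by
  refine (measurable_const.mul (Finset.measurable_fun_sum _ fun i _ => ?_)).add
    (measurable_const.mul (Finset.measurable_fun_sum _ fun i _ => ?_))
  · exact measurable_comp_estimator (g := fun x θ => S.fd (r x θ))
      (fun _ hθ => hS.measurable_fd hr hθ)
      (fun x => (hr.contDiffOn_comp hS.contDiffOn_fd x).continuousOn) (h.measurable_d i) ht htΘ
  · exact measurable_comp_estimator (g := fun x θ => S.fn (r x θ))
      (fun _ hθ => hS.measurable_fn hr hθ)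
      (fun x => (hr.contDiffOn_comp hS.contDiffOn_fn x).continuousOn) (h.measurable_n i) ht htΘ

theorem Scheme.Regular.measurable_influenceN (hS : S.Regular Θ r P) (hr : IsRatioModel Θ r)
    (hP : P.InModel Θ r) : Measurable (S.influenceN r f P) :=
  (hS.measurable_fn hr hP.mem).add (hS.measurable_cUη hP)

theorem Scheme.Regular.measurable_influenceD (hS : S.Regular Θ r P) (hr : IsRatioModel Θ r)
    (hP : P.InModel Θ r) : Measurable (S.influenceD r f P) :=
  (hS.measurable_fd hr hP.mem).sub ((hr.measurable _ hP.mem).mul (hS.measurable_cUη hP))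

theorem Scheme.Regular.memLp_influenceN (hS : S.Regular Θ r P) :
    MemLp (S.influenceN r f P) 2 P.Pn := hS.memLp_fn.add hS.memLp_cUη

theorem Scheme.Regular.memLp_influenceD (hS : S.Regular Θ r P) :
    MemLp (S.influenceD r f P) 2 P.Pd := hS.memLp_fd.sub hS.memLp_mul_cUη

/-- The term cᵀU⁻¹η cancels, so the numerator part alone determines the denominator part. -/
theorem Scheme.influenceD_add (hr : IsRatioModel Θ r) (hP : P.InModel Θ r)
    (hdec : S.Decomposes f) (x : X) :
    S.influenceD r f P x = f (r x P.θ) - r x P.θ * S.influenceN r f P x := by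
  rw [hdec _ (hr.pos x _ hP.mem), Scheme.influenceD, Scheme.influenceN]
  ring

/-- The linearized estimator is unbiased: E_d[r φ] = E_n[φ] for the numerator part φ. -/
theorem Scheme.Regular.integral_influence (hS : S.Regular Θ r P) (hr : IsRatioModel Θ r)
    (hP : P.InModel Θ r) (hdec : S.Decomposes f) :
    ∫ x, S.influenceD r f P x ∂P.Pd + ∫ x, S.influenceN r f P x ∂P.Pn =
      fDivergence f P.Pd P.Pn := by
  have := hP.prob_d
  have := hP.prob_n
  have h1 : Integrable (S.influenceN r f P) P.Pn := hS.memLp_influenceN.integrable one_le_two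
  have h2 : Integrable (S.influenceD r f P) P.Pd := hS.memLp_influenceD.integrable one_le_two
  rw [hP.fDivergence_eq hr, hP.integral_eq hr, ← integral_add h2 ((hP.integrable_iff hr).1 h1)]
  refine integral_congr_ae (Eventually.of_forall fun x => ?_)
  simp only [S.influenceD_add hr hP hdec x]
  ring

theorem Scheme.leadingVariance_eq (S : Scheme X d) :
    S.leadingVariance r f ρ P = ρ / (ρ + 1) * Var[S.influenceD r f P; P.Pd]
      + 1 / (ρ + 1) * Var[S.influenceN r f P; P.Pn] := rfl

/-- The asymptotic normality of a regular moment matching estimator. -/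
theorem Scheme.Regular.hasAsymptoticVariance (hS : S.Regular Θ r P) (hr : IsRatioModel Θ r)
    (hP : P.InModel Θ r) (hdec : S.Decomposes f) (hρ : 0 < ρ) :
    Scheme.HasAsymptoticVariance.{u, w} S Θ r f ρ P (S.leadingVariance r f ρ P) := by
  refine ⟨?_, ?_⟩
  · rw [S.leadingVariance_eq]
    have := variance_nonneg (S.influenceD r f P) P.Pd
    have := variance_nonneg (S.influenceN r f P) P.Pn
    positivity
  intro Ω _ μ _ xn xd mn md θhat h hs hθ
  have hclt := tendstoInDistribution_twoSample h hs hρ (hS.measurable_influenceN (f := f) hr hP)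
    (hS.measurable_influenceD (f := f) hr hP) hS.memLp_influenceN hS.memLp_influenceD
  rw [hS.integral_influence hr hP hdec] at hclt
  refine tendstoInDistribution_of_tendstoInMeasure_sub _ _ hclt ?_ fun k => ?_
  · refine tendsto_inProb_iff.1 ?_
    -- The remainder is o(Q), so after scaling it is o(√m Q), and √m Q is tight.
    refine (hS.boundedInProb_Q hr hP hρ h hs).tendsto_zero_of_isLittleO ?_
    have hO : (fun q : ℕ × Ω => √(effSize (mn q.1) (md q.1))) =O[inProb μ]
        fun q : ℕ × Ω => √(effSize (mn q.1) (md q.1)) := isBigO_refl _ _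
    refine (hO.smul_isLittleO (hS.estimate_linearization hr hP hdec h hs hθ)).congr_left
      fun q => ?_
    simp only [Pi.sub_apply, smul_eq_mul]
    ring
  · exact (measurable_const.mul ((hS.measurable_estimate hr h (hθ.measurable k) (hθ.mem k)
      _ _).sub_const _)).aemeasurable

end Normality

/-! ### Orthogonality and minimality of the variance -/

section Optimality

variable {X : Type u} [MeasurableSpace X] {d : ℕ} {Θ : Set (Fin d → ℝ)}
  {r : X → (Fin d → ℝ) → ℝ} {P : TwoSampleLaw X d} {S T : Scheme X d} {f : ℝ → ℝ} {ρ : ℝ}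

omit [MeasurableSpace X] in
theorem mem_linSpace_iff {g : X → Fin d → ℝ} {h : X → ℝ} :
    h ∈ linSpace g ↔ ∃ a : Fin d → ℝ, ∀ x, h x = ∑ k, a k * g x k := by
  rw [linSpace, Submodule.mem_span_range_iff_exists_fun]
  refine exists_congr fun a => ?_
  rw [funext_iff]
  refine forall_congr' fun x => ?_
  rw [Finset.sum_apply]
  simp [eq_comm]

/-- The influence functions of two regular estimators differ by a function that is orthogonal to
the score functions. -/
theorem Scheme.Regular.integral_influence_sub_mul (hS : S.Regular Θ r P) (hT : T.Regular Θ r P)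
    (hr : IsRatioModel Θ r) (hP : P.InModel Θ r) (hSd : S.Decomposes f) (hTd : T.Decomposes f)
    {h : X → ℝ} (hh : h ∈ linSpace (gradLog r P.θ)) :
    ∫ x, (S.influenceN r f P x - T.influenceN r f P x) * h x ∂P.Pn = 0 := by
  -- The inverse in the weight undoes `U`, which leaves `c`.
  have key : ∀ (R : Scheme X d), R.Regular Θ r P → ∀ k,
      Integrable (fun x => R.cUη r f P x * gradLog r P.θ x k) P.Pn ∧
      ∫ x, R.cUη r f P x * gradLog r P.θ x k ∂P.Pn = R.c r f P k := by
    intro R hR k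
    have e : (fun x => R.cUη r f P x * gradLog r P.θ x k) =
        fun x => ∑ i, R.weight r f P i * (R.η x P.θ i * gradLog r P.θ x k) := by
      ext x
      rw [R.cUη_eq_sum, Finset.sum_mul]
      exact Finset.sum_congr rfl fun i _ => by ring
    have hi : ∀ i, Integrable (fun x => R.weight r f P i * (R.η x P.θ i * gradLog r P.θ x k))
        P.Pn := fun i => (hR.integrable_η_mul_gradLog hr hP i k).const_mul _
    rw [e, integral_finsetSum _ fun i _ => hi i]
    refine ⟨integrable_finsetSum _ fun i _ => hi i, ?_⟩
    simp only [integral_const_mul]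
    rw [← hR.weight_vecMul_U]
    rfl
  have hk : ∀ k,
      Integrable (fun x => (S.influenceN r f P x - T.influenceN r f P x) * gradLog r P.θ x k)
        P.Pn ∧
      ∫ x, (S.influenceN r f P x - T.influenceN r f P x) * gradLog r P.θ x k ∂P.Pn = 0 := by
    intro k
    -- The f' terms are inserted and cancel, because f_n ∇log r need not be integrable alone while
    -- each {f' - f_n}∇log r is.
    have e : (fun x => (S.influenceN r f P x - T.influenceN r f P x) * gradLog r P.θ x k) =
        fun x => (((deriv f (r x P.θ) - T.fn (r x P.θ)) * gradLog r P.θ x k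
          - (deriv f (r x P.θ) - S.fn (r x P.θ)) * gradLog r P.θ x k)
          + S.cUη r f P x * gradLog r P.θ x k) - T.cUη r f P x * gradLog r P.θ x k := by
      ext x
      simp only [Scheme.influenceN]
      ring
    have i1 := hT.integrable_c hr hP hTd k
    have i2 := hS.integrable_c hr hP hSd k
    have i3 : Integrable (fun x => (deriv f (r x P.θ) - T.fn (r x P.θ)) * gradLog r P.θ x k
        - (deriv f (r x P.θ) - S.fn (r x P.θ)) * gradLog r P.θ x k) P.Pn := i1.sub i2
    have i4 : Integrable (fun x => ((deriv f (r x P.θ) - T.fn (r x P.θ)) * gradLog r P.θ x k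
        - (deriv f (r x P.θ) - S.fn (r x P.θ)) * gradLog r P.θ x k)
          + S.cUη r f P x * gradLog r P.θ x k) P.Pn := i3.add (key S hS k).1
    rw [e]
    refine ⟨i4.sub (key T hT k).1, ?_⟩
    rw [integral_sub i4 (key T hT k).1, integral_add i3 (key S hS k).1, integral_sub i1 i2,
      (key S hS k).2, (key T hT k).2]
    simp only [Scheme.c]
    ring
  obtain ⟨a, ha⟩ := mem_linSpace_iff.1 hh
  have e : (fun x => (S.influenceN r f P x - T.influenceN r f P x) * h x) = fun x =>
      ∑ k, a k * ((S.influenceN r f P x - T.influenceN r f P x) * gradLog r P.θ x k) := by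
    ext x
    rw [ha, Finset.mul_sum]
    exact Finset.sum_congr rfl fun i _ => by ring
  rw [e, integral_finsetSum _ fun k _ => (hk k).1.const_mul _]
  simp [integral_const_mul, (hk _).2]

/-- The sufficient condition for optimality of the influence function. -/
theorem Scheme.Regular.leadingVariance_le (hS : S.Regular Θ r P) (hT : T.Regular Θ r P)
    (hr : IsRatioModel Θ r) (hP : P.InModel Θ r) (hSd : S.Decomposes f) (hTd : T.Decomposes f)
    (hρ : 0 < ρ) (hone : (fun _ : X => (1 : ℝ)) ∈ linSpace (gradLog r P.θ))
    (hcond : (fun x => f (r x P.θ) - (r x P.θ + ρ⁻¹) * T.influenceN r f P x)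
      ∈ linSpace (gradLog r P.θ)) :
    T.leadingVariance r f ρ P ≤ S.leadingVariance r f ρ P := by
  have := hP.prob_d
  have := hP.prob_n
  set δ : X → ℝ := S.influenceN r f P - T.influenceN r f P with hδ
  have hTn : MemLp (T.influenceN r f P) 2 P.Pn := hT.memLp_influenceN
  have hTd' : MemLp (T.influenceD r f P) 2 P.Pd := hT.memLp_influenceD
  have hδn : MemLp δ 2 P.Pn := hS.memLp_influenceN.sub hTn
  have hD : S.influenceD r f P = T.influenceD r f P - fun x => r x P.θ * δ x := by
    ext x
    simp only [Pi.sub_apply, S.influenceD_add hr hP hSd, T.influenceD_add hr hP hTd, hδ]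
    ring
  have hN : S.influenceN r f P = T.influenceN r f P + δ := by
    rw [hδ]; abel
  -- This does not follow from δ ∈ L²(p_n), since r may be unbounded; it comes from the denominator
  -- parts.
  have hδd : MemLp (fun x => r x P.θ * δ x) 2 P.Pd := by
    have : (fun x => r x P.θ * δ x) = T.influenceD r f P - S.influenceD r f P := by
      rw [hD]; abel
    rw [this]
    exact hTd'.sub hS.memLp_influenceD
  have hδ0 : ∫ x, δ x ∂P.Pn = 0 := by
    have := hS.integral_influence_sub_mul hT hr hP hSd hTd hone
    simp only [mul_one] at this
    exact this
  have hδd0 : ∫ x, r x P.θ * δ x ∂P.Pd = 0 := by rw [← hP.integral_eq hr, hδ0]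
  have hcross := hS.integral_influence_sub_mul hT hr hP hSd hTd hcond
  have i1 : Integrable (fun x => T.influenceN r f P x * δ x) P.Pn := hTn.integrable_mul hδn
  have i2 : Integrable (fun x => T.influenceD r f P x * δ x) P.Pn := by
    rw [hP.integrable_iff hr]
    refine (hTd'.integrable_mul hδd).congr (Eventually.of_forall fun x => ?_)
    simp only [Pi.mul_apply]
    ring
  have hcov : cov[T.influenceD r f P, fun x => r x P.θ * δ x; P.Pd] =
      ∫ x, T.influenceD r f P x * δ x ∂P.Pn := by
    rw [covariance_eq_sub hTd' hδd, hδd0, mul_zero, sub_zero, hP.integral_eq hr]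
    refine integral_congr_ae (Eventually.of_forall fun x => ?_)
    simp only [Pi.mul_apply]
    ring
  have hcov' : cov[T.influenceN r f P, δ; P.Pn] = ∫ x, T.influenceN r f P x * δ x ∂P.Pn := by
    rw [covariance_eq_sub hTn hδn, hδ0, mul_zero, sub_zero]
    rfl
  -- As T's denominator part is f(r) - rφ̄, the difference of the two sides is the integral in
  -- `hcross`.
  have hzero : ∫ x, T.influenceD r f P x * δ x ∂P.Pn
      = ρ⁻¹ * ∫ x, T.influenceN r f P x * δ x ∂P.Pn := by
    rw [← sub_eq_zero, ← integral_const_mul, ← integral_sub i2 (i1.const_mul _), ← hcross]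
    refine integral_congr_ae (Eventually.of_forall fun x => ?_)
    simp only [T.influenceD_add hr hP hTd, hδ, Pi.sub_apply]
    ring
  rw [S.leadingVariance_eq, T.leadingVariance_eq, hD, hN, variance_sub hTd' hδd,
    variance_add hTn hδn, hcov, hcov', hzero]
  have v1 := variance_nonneg (fun x => r x P.θ * δ x) P.Pd
  have v2 := variance_nonneg δ P.Pn
  -- The covariances enter with opposite signs, so they cancel.
  have e : ρ / (ρ + 1) * (2 * (ρ⁻¹ * ∫ x, T.influenceN r f P x * δ x ∂P.Pn)) =
      1 / (ρ + 1) * (2 * ∫ x, T.influenceN r f P x * δ x ∂P.Pn) := by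
    field_simp
  have p1 : 0 ≤ ρ / (ρ + 1) * Var[fun x => r x P.θ * δ x; P.Pd] := by positivity
  have p2 : 0 ≤ 1 / (ρ + 1) * Var[δ; P.Pn] := by positivity
  linarith

end Optimality

end DensityRatio

end

theorem theorem1 {X : Type u} [MeasurableSpace X] {d : ℕ}
    (Θ : Set (Fin d → ℝ)) (r : X → (Fin d → ℝ) → ℝ) (f : ℝ → ℝ) (ρ : ℝ)
    (hr : DensityRatio.IsRatioModel Θ r) (hf : DensityRatio.IsGenerator f)
    (hA : DensityRatio.ModelAssumption Θ r f) (hρ : 0 < ρ)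
    (M : Set (DensityRatio.TwoSampleLaw X d)) (hM : ∀ P ∈ M, P.InModel Θ r)
    (Sbar : DensityRatio.Scheme X d) (hdec : Sbar.Decomposes f)
    (hreg : ∀ P ∈ M, Sbar.Regular Θ r P)
    (hcond : ∀ P ∈ M,
      (fun x => f (r x P.θ) - (r x P.θ + ρ⁻¹) * (Sbar.fn (r x P.θ) + Sbar.cUη r f P x))
        ∈ DensityRatio.linSpace (DensityRatio.gradLog r P.θ)) :
    ∀ P ∈ M,
      DensityRatio.Scheme.HasAsymptoticVariance.{u, w} Sbar Θ r f ρ P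
        (Sbar.leadingVariance r f ρ P) ∧
      ∀ S : DensityRatio.Scheme X d, S.Decomposes f → S.Regular Θ r P →
        DensityRatio.Scheme.HasAsymptoticVariance.{u, w} S Θ r f ρ P
          (S.leadingVariance r f ρ P) ∧
        Sbar.leadingVariance r f ρ P ≤ S.leadingVariance r f ρ P := by
  intro P hPM
  have hP := hM P hPM
  have hT := hreg P hPM
  refine ⟨hT.hasAsymptoticVariance hr hP hdec hρ, fun S hSd hS =>
    ⟨hS.hasAsymptoticVariance hr hP hSd hρ, ?_⟩⟩
  exact hS.leadingVariance_le hT hr hP hSd hdec hρ (hA.one_mem_linSpace P.θ hP.mem) (hcond P hPM)
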